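/- **Setting.** Let $\Omega=(0,\ell_1)\times(0,\ell_2)\times(0,\ell_3)$ be divided into $N_1\times N_2\times N_3$ equal closed rectangular cells with side lengths $h_i=\ell_i/N_i$, where $N_1,N_2,N_3\ge 1$ are even, and let $h\ge\max_i h_i$ (for a mesh of cubes, $h$ may be their side length). Let $f\in L^2(\Omega)$ with $\int_\Omega f=0$. Let $V^h_\#$ be the space of functions that are linear polynomials on every cell, whose averages over every interior face from its two sides coincide, and whose averages over the two faces of every pair of opposite boundary faces coincide. For piecewise linear $u,v$ put $a_h(u,v)=\sum_K\int_K\nabla u\cdot\nabla v$ and $|v|_{1,h}=a_h(v,v)^{1/2}$; $\|\cdot\|_0$ is the norm of $L^2(\Omega)$. * $\mathfrak B=\{\phi_z\}$ is the set of node-based functions, one for each of the $N_1N_2N_3$ mesh nodes $z$ (opposite boundary nodes being identified periodically): $\phi_z\in V^h_\#$ has the value $\frac12$ at the barycenters of the faces containing $z$ and $0$ at the barycenters of all other faces. * $\mathfrak A=\{(\psi^\iota_j)_\mu:\iota\neq\mu,\ 1\le j\le N_\iota\}$ is the set of alternating functions: $(\psi^\iota_j)_\mu\in V^h_\#$ is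 supported in the $j$-th layer of cells perpendicular to the direction $\iota$; in that layer its values at the barycenters of the faces perpendicular to $\mu$ are $\pm1$, with signs alternating in the two directions other than $\iota$, and its values at the barycenters of all other faces are $0$. * $\mathfrak B^\flat\subset\mathfrak B$ is any subset that is a basis of $V^h_\#\cap\operatorname{Span}\mathfrak B$. $\mathfrak A^\flat\subset\mathfrak A$ is any subset that contains, for each direction $\mu$, exactly $\sum_{\iota\ne\mu}N_\iota-1$ of the functions $(\psi^\iota_j)_\mu$. * Let $1=\sum_{\phi\in\mathfrak B^\flat}w_\phi\,\phi$ be the expansion of the constant function $1$ in $\mathfrak B^\flat$. An element $\phi_*$ of $\mathfrak B^\flat$ is called an admissible last element if $w_{\phi_*}\ne0$. For a set $\mathfrak S$ of functions let $\mathbf S^{\mathfrak S}$ be its stiffness matrix $(a_h(s',s))_{s,s'\in\mathfrak S}$ and $\int_\Omega f\mathfrak S$ the vector $(\int_\Omega fs)_{s\in\mathfrak S}$; a coefficient vector represents the corresponding linear combination. Consider the following numerical solutions. 1. $u_h$ is represented by a solution of the system with the matrix $\operatorname{diag}(\mathbf S^{\mathfrak B^\flat},\mathbf S^{\mathfrak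 A^\flat})$ and the right-hand side $(\int_\Omega f\mathfrak B^\flat,\int_\Omega f\mathfrak A^\flat)$, modified in the row of an admissible last element $\phi_*$: in that row the entries of $\mathbf S^{\mathfrak B^\flat}$ are replaced by $1$ and the entry of the right-hand side by $0$. 2. $u^\flat_h$ is represented by a solution of the unmodified system of 1. whose coefficients belonging to $\mathfrak B^\flat$ have sum $0$. 3. $u^\natural_h$ is represented by a solution of the system with the matrix $\operatorname{diag}(\mathbf S^{\mathfrak B},\mathbf S^{\mathfrak A})$ and the right-hand side $(\int_\Omega f\mathfrak B,\int_\Omega f\mathfrak A)$ whose coefficients belonging to $\mathfrak B$ have sum $0$. 4. $\bar u^\natural_h$ is represented by a Krylov solution of $\mathbf S^{\mathfrak B}\mathbf u=\mathbf b:=\int_\Omega f\mathfrak B$ from an initial vector $\mathbf u^{(0)}$ whose coefficients have sum $0$, that is, a solution with $\mathbf u-\mathbf u^{(0)}\in\operatorname{Span}\{(\mathbf S^{\mathfrak B})^n(\mathbf b-\mathbf S^{\mathfrak B}\mathbf u^{(0)}):n\ge0\}$. **Theorem.** An admissible last element exists. The coefficient vectors in 1 (for every admissible last element) and in 2 exist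 and are unique; a coefficient vector in 3 exists; the coefficient vector in 4 exists and is unique for every initial vector whose coefficients have sum $0$. For all choices made above, $$u_h=u^\flat_h=u^\natural_h,$$ and $$\|u^\natural_h-\bar u^\natural_h\|_0\le C h^2\|f\|_0,\qquad |u^\natural_h-\bar u^\natural_h|_{1,h}\le C h\|f\|_0,$$ with a constant $C$ that does not depend on $h$, the $\ell_i$, the $N_i$, $f$ or any of the choices made. -/

import Mathlib

open MeasureTheory

noncomputable section

namespace P1NC

/-! ### The uniform rectangular mesh of the box `∏ (0, ℓ i)` -/

/-- The open box `Ω = (0, ℓ₀) × (0, ℓ₁) × (0, ℓ₂)`. -/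
def Omega (ℓ : Fin 3 → ℝ) : Set (Fin 3 → ℝ) :=
  Set.univ.pi fun i => Set.Ioo 0 (ℓ i)

/-- Cells of the mesh with `N i` cells in direction `i`, indexed from `0`. -/
abbrev Cell (N : Fin 3 → ℕ) : Type := (i : Fin 3) → Fin (N i)

/-- Nodes after periodic identification of opposite boundary nodes: the node with index `z`
has coordinates `z i * step i`, and index `N i` is identified with index `0`. -/
abbrev Node (N : Fin 3 → ℕ) : Type := (i : Fin 3) → Fin (N i)

/-- Side length of every cell in direction `i`. -/
def step (ℓ : Fin 3 → ℝ) (N : Fin 3 → ℕ) (i : Fin 3) : ℝ := ℓ i / (N i : ℝ)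

/-- Lower end of the cell `k` in direction `i`. -/
def lo (ℓ : Fin 3 → ℝ) (N : Fin 3 → ℕ) (k : Cell N) (i : Fin 3) : ℝ :=
  ((k i : ℕ) : ℝ) * step ℓ N i

/-- Upper end of the cell `k` in direction `i`. -/
def hi (ℓ : Fin 3 → ℝ) (N : Fin 3 → ℕ) (k : Cell N) (i : Fin 3) : ℝ :=
  (((k i : ℕ) : ℝ) + 1) * step ℓ N i

/-- Barycenter of the cell `k`. -/
def center (ℓ : Fin 3 → ℝ) (N : Fin 3 → ℕ) (k : Cell N) : Fin 3 → ℝ :=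
  fun i => (((k i : ℕ) : ℝ) + 1 / 2) * step ℓ N i

/-- The open cell with index `k`. -/
def cellSet (ℓ : Fin 3 → ℝ) (N : Fin 3 → ℕ) (k : Cell N) : Set (Fin 3 → ℝ) :=
  Set.univ.pi fun i => Set.Ioo (lo ℓ N k i) (hi ℓ N k i)

/-- The neighbour of `k` in the positive direction `i`; addition in `Fin (N i)` is modulo `N i`,
so the last cell is followed, periodically, by the first one. -/
def nextCell {N : Fin 3 → ℕ} [∀ i, NeZero (N i)] (i : Fin 3) (k : Cell N) : Cell N :=
  Function.update k i (k i + 1)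

/-! ### Piecewise linear functions -/

/-- Piecewise linear functions: a polynomial of degree at most one on each cell. -/
abbrev BrokenP1 (N : Fin 3 → ℕ) : Type := Cell N → ((Fin 3 → ℝ) →ᵃ[ℝ] ℝ)

/-- The function on `Ω` (defined up to the null set of cell boundaries) given by the pieces. -/
def toFunc (ℓ : Fin 3 → ℝ) {N : Fin 3 → ℕ} (v : BrokenP1 N) (x : Fin 3 → ℝ) : ℝ :=
  ∑ k, (cellSet ℓ N k).indicator (fun y => v k y) x

/-- The (constant) partial derivative of a linear polynomial. -/
def partialDeriv (i : Fin 3) (p : (Fin 3 → ℝ) →ᵃ[ℝ] ℝ) : ℝ := p.linear (Pi.single i 1)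

/-- The broken bilinear form `a_h(u, v) = ∑_K ∫_K ∇u · ∇v`. -/
def energy (ℓ : Fin 3 → ℝ) {N : Fin 3 → ℕ} (u v : BrokenP1 N) : ℝ :=
  ∑ k, ∫ _x in cellSet ℓ N k, ∑ i, partialDeriv i (u k) * partialDeriv i (v k)

/-- The broken energy norm `|v|_{1,h}`. -/
def energyNorm (ℓ : Fin 3 → ℝ) {N : Fin 3 → ℕ} (v : BrokenP1 N) : ℝ :=
  Real.sqrt (energy ℓ v v)

/-- The norm of `L²(Ω)`. -/
def l2Norm (ℓ : Fin 3 → ℝ) (g : (Fin 3 → ℝ) → ℝ) : ℝ :=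
  Real.sqrt (∫ x in Omega ℓ, g x ^ 2)

/-- Average of `p` over the face of the cell `k` that is perpendicular to direction `i` and lies
in the plane `x i = c`. -/
def faceAvg (ℓ : Fin 3 → ℝ) (N : Fin 3 → ℕ) (k : Cell N) (i : Fin 3) (c : ℝ)
    (p : (Fin 3 → ℝ) →ᵃ[ℝ] ℝ) : ℝ :=
  ⨍ y in Set.Icc (fun j : Fin 2 => lo ℓ N k (i.succAbove j))
    (fun j : Fin 2 => hi ℓ N k (i.succAbove j)), p (i.insertNth c y)

/-- Value of `p` at the barycenter of the same face. -/
def faceMid (ℓ : Fin 3 → ℝ) (N : Fin 3 → ℕ) (k : Cell N) (i : Fin 3) (c : ℝ)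
    (p : (Fin 3 → ℝ) →ᵃ[ℝ] ℝ) : ℝ :=
  p (Function.update (center ℓ N k) i c)

theorem integrableOn_face (i : Fin 3) (c : ℝ) (p : (Fin 3 → ℝ) →ᵃ[ℝ] ℝ) (a b : Fin 2 → ℝ) :
    IntegrableOn (fun y : Fin 2 → ℝ => p (i.insertNth c y)) (Set.Icc a b) := by
  have hp : Continuous p := p.continuous_of_finiteDimensional
  have hi : Continuous fun y : Fin 2 → ℝ => (i.insertNth c y : Fin 3 → ℝ) := by
    refine continuous_pi fun j => ?_
    rcases Fin.eq_self_or_eq_succAbove i j with rfl | ⟨j, rfl⟩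
    · simpa using continuous_const
    · simpa using continuous_apply j
  exact (hp.comp hi).continuousOn.integrableOn_compact isCompact_Icc

theorem faceAvg_add (ℓ : Fin 3 → ℝ) (N : Fin 3 → ℕ) (k : Cell N) (i : Fin 3) (c : ℝ)
    (p q : (Fin 3 → ℝ) →ᵃ[ℝ] ℝ) :
    faceAvg ℓ N k i c (p + q) = faceAvg ℓ N k i c p + faceAvg ℓ N k i c q := by
  simp only [faceAvg, setAverage_eq, AffineMap.coe_add, Pi.add_apply]
  rw [integral_add (integrableOn_face i c p _ _) (integrableOn_face i c q _ _), smul_add]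

theorem faceAvg_smul (ℓ : Fin 3 → ℝ) (N : Fin 3 → ℕ) (k : Cell N) (i : Fin 3) (c : ℝ)
    (r : ℝ) (p : (Fin 3 → ℝ) →ᵃ[ℝ] ℝ) :
    faceAvg ℓ N k i c (r • p) = r * faceAvg ℓ N k i c p := by
  simp only [faceAvg, setAverage_eq, AffineMap.coe_smul, Pi.smul_apply, smul_eq_mul,
    integral_const_mul]
  ring

theorem faceAvg_zero (ℓ : Fin 3 → ℝ) (N : Fin 3 → ℕ) (k : Cell N) (i : Fin 3) (c : ℝ) :
    faceAvg ℓ N k i c 0 = 0 := by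
  simp [faceAvg]

/-- The nonconforming space `V^h`: the face averages from the two sides of every interior face
coincide. -/
def Vh (ℓ : Fin 3 → ℝ) (N : Fin 3 → ℕ) [∀ i, NeZero (N i)] : Submodule ℝ (BrokenP1 N) where
  carrier := {v | ∀ (i : Fin 3) (k : Cell N), (k i : ℕ) + 1 < N i →
    faceAvg ℓ N k i (hi ℓ N k i) (v k) =
      faceAvg ℓ N (nextCell i k) i (lo ℓ N (nextCell i k) i) (v (nextCell i k))}
  add_mem' := by
    intro u v hu hv i k hk
    simp only [Pi.add_apply, faceAvg_add, hu i k hk, hv i k hk]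
  zero_mem' := by
    intro i k _
    simp only [Pi.zero_apply, faceAvg_zero]
  smul_mem' := by
    intro r v hv i k hk
    simp only [Pi.smul_apply, faceAvg_smul, hv i k hk]

/-- The periodic space `V^h_#`: functions of `V^h` whose averages over the two faces of every pair
of opposite boundary faces coincide. -/
def Vper (ℓ : Fin 3 → ℝ) (N : Fin 3 → ℕ) [∀ i, NeZero (N i)] : Submodule ℝ (BrokenP1 N) where
  carrier := {v | v ∈ Vh ℓ N ∧ ∀ (i : Fin 3) (k : Cell N), (k i : ℕ) + 1 = N i →
    faceAvg ℓ N k i (hi ℓ N k i) (v k) =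
      faceAvg ℓ N (nextCell i k) i (lo ℓ N (nextCell i k) i) (v (nextCell i k))}
  add_mem' := by
    intro u v hu hv
    refine ⟨add_mem hu.1 hv.1, fun i k hk => ?_⟩
    simp only [Pi.add_apply, faceAvg_add, hu.2 i k hk, hv.2 i k hk]
  zero_mem' := by
    refine ⟨zero_mem _, fun i k _ => ?_⟩
    simp only [Pi.zero_apply, faceAvg_zero]
  smul_mem' := by
    intro r v hv
    refine ⟨Submodule.smul_mem _ r hv.1, fun i k hk => ?_⟩
    simp only [Pi.smul_apply, faceAvg_smul, hv.2 i k hk]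

/-! ### Node-based functions and alternating functions -/

/-- The linear polynomial with value `a` at the point `c` and gradient `g`. -/
def linPoly (c : Fin 3 → ℝ) (a : ℝ) (g : Fin 3 → ℝ) : (Fin 3 → ℝ) →ᵃ[ℝ] ℝ where
  toFun x := a + ∑ i, g i * (x i - c i)
  linear := ∑ i, g i • LinearMap.proj i
  map_vadd' := by
    intro x v
    simp only [Fin.sum_univ_three, vadd_eq_add, Pi.add_apply, LinearMap.add_apply,
      LinearMap.smul_apply, LinearMap.proj_apply, smul_eq_mul]
    ring

/-- The node-based function `φ_z`: its value at the barycenter of a face is `1/2` if the face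
contains `z` (up to periodic identification) and `0` otherwise. -/
def nodeFun (ℓ : Fin 3 → ℝ) (N : Fin 3 → ℕ) [∀ i, NeZero (N i)] (z : Node N) : BrokenP1 N :=
  fun k =>
    if ∀ i, z i = k i ∨ z i = k i + 1 then
      linPoly (center ℓ N k) (1 / 4)
        (fun i => (if z i = k i + 1 then 1 else -1) / (2 * step ℓ N i))
    else 0

/-- Indices of the alternating functions `(ψ^ι_j)_μ`: two different directions `ι = p.1`,
`μ = p.2` and the index `j` of a layer of cells perpendicular to direction `ι`. -/
abbrev AltIdx (N : Fin 3 → ℕ) : Type :=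
  Σ p : {p : Fin 3 × Fin 3 // p.1 ≠ p.2}, Fin (N p.1.1)

/-- The alternating function `(ψ^ι_j)_μ`: it is supported in the layer of cells `k` with `k ι = j`;
there its values at the barycenters of the faces perpendicular to direction `μ` are `±1`, with
signs alternating in the two directions other than `ι`, and its values at the barycenters of the
other faces are `0`. -/
def altFun (ℓ : Fin 3 → ℝ) (N : Fin 3 → ℕ) (a : AltIdx N) : BrokenP1 N :=
  fun k =>
    if k a.1.1.1 = a.2 then
      linPoly (center ℓ N k) 0
        (fun i => if i = a.1.1.2 then
          -2 * (-1) ^ (∑ m ∈ Finset.univ.erase a.1.1.1, (k m : ℕ)) / step ℓ N i else 0)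
    else 0

theorem step_pos {ℓ : Fin 3 → ℝ} (hℓ : ∀ i, 0 < ℓ i) (N : Fin 3 → ℕ) [∀ i, NeZero (N i)]
    (i : Fin 3) : 0 < step ℓ N i :=
  div_pos (hℓ i) (Nat.cast_pos.mpr (Nat.pos_of_ne_zero (NeZero.ne _)))

/-- The average of a linear polynomial over a face is its value at the barycenter. -/
theorem faceAvg_eq_faceMid {ℓ : Fin 3 → ℝ} (hℓ : ∀ i, 0 < ℓ i) (N : Fin 3 → ℕ)
    [∀ i, NeZero (N i)] (k : Cell N) (i : Fin 3) (c : ℝ) (p : (Fin 3 → ℝ) →ᵃ[ℝ] ℝ) :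
    faceAvg ℓ N k i c p = faceMid ℓ N k i c p := by
  set a : Fin 2 → ℝ := fun j => lo ℓ N k (i.succAbove j) with ha
  set b : Fin 2 → ℝ := fun j => hi ℓ N k (i.succAbove j) with hb
  have hab : ∀ j, a j < b j := fun j => by
    simp only [ha, hb, lo, hi]
    nlinarith [step_pos hℓ N (i.succAbove j)]
  have hint := integrableOn_face i c p a b
  have hpre : (fun y : Fin 2 → ℝ => (a + b) - y) ⁻¹' Set.Icc a b = Set.Icc a b := by
    ext y
    simp only [Set.mem_preimage, Set.mem_Icc, Pi.le_def, Pi.sub_apply, Pi.add_apply]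
    constructor
    · rintro ⟨h1, h2⟩
      exact ⟨fun j => by linarith [h2 j], fun j => by linarith [h1 j]⟩
    · rintro ⟨h1, h2⟩
      exact ⟨fun j => by linarith [h2 j], fun j => by linarith [h1 j]⟩
  have hmp := (volume : Measure (Fin 2 → ℝ)).measurePreserving_sub_left (a + b)
  have hemb : MeasurableEmbedding fun y : Fin 2 → ℝ => (a + b) - y :=
    (MeasurableEquiv.subLeft (a + b)).measurableEmbedding
  have key := hmp.setIntegral_preimage_emb hemb
    (fun y : Fin 2 → ℝ => p (i.insertNth c y)) (Set.Icc a b)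
  have hint2 : IntegrableOn (fun y : Fin 2 → ℝ => p (i.insertNth c ((a + b) - y)))
      (Set.Icc a b) := by
    have := (hmp.integrableOn_comp_preimage hemb
      (f := fun y : Fin 2 → ℝ => p (i.insertNth c y)) (s := Set.Icc a b)).2 hint
    rwa [hpre] at this
  rw [hpre] at key
  have hpt : ∀ y : Fin 2 → ℝ, p (i.insertNth c y) + p (i.insertNth c ((a + b) - y)) =
      2 * faceMid ℓ N k i c p := by
    intro y
    have hv : (i.insertNth c y : Fin 3 → ℝ) + i.insertNth c ((a + b) - y) =
        (2 : ℝ) • Function.update (center ℓ N k) i c := by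
      ext m
      rcases Fin.eq_self_or_eq_succAbove i m with rfl | ⟨m, rfl⟩
      · simp; ring
      · simp [ha, hb, lo, hi, center]; ring
    have hd : ∀ x, p x = p.linear x + p 0 := fun x => congrFun p.decomp x
    have h1 := congrArg p.linear hv
    rw [map_add, map_smul, smul_eq_mul] at h1
    rw [faceMid, hd, hd (i.insertNth c ((a + b) - y)), hd (Function.update _ _ _)]
    linarith
  have hsum : (∫ y in Set.Icc a b, p (i.insertNth c y)) +
      (∫ y in Set.Icc a b, p (i.insertNth c ((a + b) - y))) =
      volume.real (Set.Icc a b) * (2 * faceMid ℓ N k i c p) := by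
    rw [← integral_add hint hint2]
    simp only [hpt, setIntegral_const, smul_eq_mul]
  have hvol : 0 < volume.real (Set.Icc a b) := by
    rw [Measure.real, Real.volume_Icc_pi_toReal (fun j => (hab j).le)]
    exact Finset.prod_pos fun j _ => sub_pos.2 (hab j)
  rw [faceAvg, setAverage_eq, smul_eq_mul]
  rw [key] at hsum
  change (volume.real (Set.Icc a b))⁻¹ * (∫ y in Set.Icc a b, p (i.insertNth c y)) = _
  rw [inv_mul_eq_iff_eq_mul₀ hvol.ne']
  linarith

theorem fin_val_add_one {n : ℕ} [NeZero n] (hn : Even n) (a : Fin n) :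
    ((a + 1 : Fin n) : ℕ) = if (a : ℕ) + 1 = n then 0 else (a : ℕ) + 1 := by
  have h0 : n ≠ 0 := NeZero.ne n
  have h2 : 1 < n := by
    obtain ⟨m, hm⟩ := hn
    omega
  rw [Fin.val_add, Fin.val_one', Nat.mod_eq_of_lt h2]
  split_ifs with h
  · rw [h, Nat.mod_self]
  · exact Nat.mod_eq_of_lt (by have := a.2; omega)

theorem fin_ne_add_one {n : ℕ} [NeZero n] (hn : Even n) (a : Fin n) : a ≠ a + 1 := by
  intro h
  have h1 := congrArg Fin.val h
  rw [fin_val_add_one hn] at h1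
  obtain ⟨m, hm⟩ := hn
  have := a.2
  split_ifs at h1 with h2 <;> omega

theorem neg_one_pow_add_one {n : ℕ} [NeZero n] (hn : Even n) (a : Fin n) :
    (-1 : ℝ) ^ ((a + 1 : Fin n) : ℕ) = -(-1) ^ (a : ℕ) := by
  rw [fin_val_add_one hn]
  split_ifs with h
  · have h1 : Even ((a : ℕ) + 1) := by rwa [h]
    have h2 := h1.neg_one_pow (α := ℝ)
    rw [pow_succ] at h2
    rw [pow_zero]
    linarith
  · rw [pow_succ]; ring

/-- The barycenter values of `φ_z` on upper faces; every face is, periodically, an upper face. -/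
theorem faceMid_nodeFun_hi {ℓ : Fin 3 → ℝ} (hℓ : ∀ i, 0 < ℓ i) {N : Fin 3 → ℕ}
    [∀ i, NeZero (N i)] (z : Node N) (k : Cell N) (i : Fin 3) :
    faceMid ℓ N k i (hi ℓ N k i) (nodeFun ℓ N z k) =
      if z i = k i + 1 ∧ ∀ m, m ≠ i → z m = k m ∨ z m = k m + 1 then 1 / 2 else 0 := by
  have hs := fun m => (step_pos hℓ N m).ne'
  have hc : ∀ m, Function.update (center ℓ N k) i (hi ℓ N k i) m - center ℓ N k m =
      if m = i then step ℓ N i / 2 else 0 := by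
    intro m
    by_cases h : m = i
    · subst h; simp [hi, center]; ring
    · simp [h]
  by_cases hz : ∀ m, z m = k m ∨ z m = k m + 1
  · by_cases hu : z i = k i + 1
    · rw [if_pos ⟨hu, fun m _ => hz m⟩]
      simp [faceMid, nodeFun, hz, linPoly, hc, hu]
      field_simp [hs i]
      norm_num
    · rw [if_neg fun h => hu h.1]
      simp [faceMid, nodeFun, hz, linPoly, hc, hu]
      field_simp [hs i]
      norm_num
  · rw [if_neg]
    · simp [faceMid, nodeFun, hz]
    · rintro ⟨h1, h2⟩
      refine hz fun m => ?_
      by_cases h : m = i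
      · subst h; exact Or.inr h1
      · exact h2 m h

/-- The barycenter values of `φ_z` on lower faces. -/
theorem faceMid_nodeFun_lo {ℓ : Fin 3 → ℝ} (hℓ : ∀ i, 0 < ℓ i) {N : Fin 3 → ℕ}
    [∀ i, NeZero (N i)] (hN : ∀ i, Even (N i)) (z : Node N) (k : Cell N) (i : Fin 3) :
    faceMid ℓ N k i (lo ℓ N k i) (nodeFun ℓ N z k) =
      if z i = k i ∧ ∀ m, m ≠ i → z m = k m ∨ z m = k m + 1 then 1 / 2 else 0 := by
  have hs := fun m => (step_pos hℓ N m).ne'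
  have hc : ∀ m, Function.update (center ℓ N k) i (lo ℓ N k i) m - center ℓ N k m =
      if m = i then -(step ℓ N i / 2) else 0 := by
    intro m
    by_cases h : m = i
    · subst h; simp [lo, center]; ring
    · simp [h]
  by_cases hz : ∀ m, z m = k m ∨ z m = k m + 1
  · by_cases hu : z i = k i
    · rw [if_pos ⟨hu, fun m _ => hz m⟩]
      have hne : ¬ z i = k i + 1 := by
        rw [hu]
        exact fun h => fin_ne_add_one (hN i) _ h
      simp [faceMid, nodeFun, hz, linPoly, hc, hne]
      field_simp [hs i]
      norm_num
    · rw [if_neg fun h => hu h.1]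
      have hu' : z i = k i + 1 := (hz i).resolve_left hu
      simp [faceMid, nodeFun, hz, linPoly, hc, hu']
      field_simp [hs i]
      norm_num
  · rw [if_neg]
    · simp [faceMid, nodeFun, hz]
    · rintro ⟨h1, h2⟩
      refine hz fun m => ?_
      by_cases h : m = i
      · subst h; exact Or.inl h1
      · exact h2 m h

theorem nodeFun_mem_Vper {ℓ : Fin 3 → ℝ} (hℓ : ∀ i, 0 < ℓ i) {N : Fin 3 → ℕ}
    [∀ i, NeZero (N i)] (hN : ∀ i, Even (N i)) (z : Node N) : nodeFun ℓ N z ∈ Vper ℓ N := by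
  have key : ∀ (i : Fin 3) (k : Cell N), faceAvg ℓ N k i (hi ℓ N k i) (nodeFun ℓ N z k) =
      faceAvg ℓ N (nextCell i k) i (lo ℓ N (nextCell i k) i)
        (nodeFun ℓ N z (nextCell i k)) := by
    intro i k
    rw [faceAvg_eq_faceMid hℓ, faceAvg_eq_faceMid hℓ, faceMid_nodeFun_hi hℓ,
      faceMid_nodeFun_lo hℓ hN]
    refine if_congr (and_congr (by simp [nextCell]) (forall_congr' fun m => ?_)) rfl rfl
    refine imp_congr_right fun hm => ?_
    simp [nextCell, hm]
  exact ⟨fun i k _ => key i k, fun i k _ => key i k⟩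

/-- The barycenter values of `(ψ^ι_j)_μ` on lower faces. -/
theorem faceMid_altFun_lo {ℓ : Fin 3 → ℝ} (hℓ : ∀ i, 0 < ℓ i) {N : Fin 3 → ℕ}
    [∀ i, NeZero (N i)] (a : AltIdx N) (k : Cell N) (i : Fin 3) :
    faceMid ℓ N k i (lo ℓ N k i) (altFun ℓ N a k) =
      if k a.1.1.1 = a.2 ∧ i = a.1.1.2 then
        (-1) ^ (∑ m ∈ Finset.univ.erase a.1.1.1, (k m : ℕ)) else 0 := by
  have hs := fun m => (step_pos hℓ N m).ne'
  have hc : ∀ m, Function.update (center ℓ N k) i (lo ℓ N k i) m - center ℓ N k m =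
      if m = i then -(step ℓ N i / 2) else 0 := by
    intro m
    by_cases h : m = i
    · subst h; simp [lo, center]; ring
    · simp [h]
  by_cases hk : k a.1.1.1 = a.2
  · by_cases him : i = a.1.1.2
    · rw [if_pos ⟨hk, him⟩]
      have hci := hc i
      rw [if_pos rfl, Function.update_self] at hci
      simp [faceMid, altFun, hk, linPoly, ← him, hci]
      field_simp [hs i]
    · rw [if_neg fun h => him h.2]
      simp [faceMid, altFun, hk, linPoly, Ne.symm him]
  · rw [if_neg fun h => hk h.1]
    simp [faceMid, altFun, hk]

/-- The barycenter values of `(ψ^ι_j)_μ` on upper faces. -/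
theorem faceMid_altFun_hi {ℓ : Fin 3 → ℝ} (hℓ : ∀ i, 0 < ℓ i) {N : Fin 3 → ℕ}
    [∀ i, NeZero (N i)] (a : AltIdx N) (k : Cell N) (i : Fin 3) :
    faceMid ℓ N k i (hi ℓ N k i) (altFun ℓ N a k) =
      if k a.1.1.1 = a.2 ∧ i = a.1.1.2 then
        -(-1) ^ (∑ m ∈ Finset.univ.erase a.1.1.1, (k m : ℕ)) else 0 := by
  have hs := fun m => (step_pos hℓ N m).ne'
  have hc : ∀ m, Function.update (center ℓ N k) i (hi ℓ N k i) m - center ℓ N k m =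
      if m = i then step ℓ N i / 2 else 0 := by
    intro m
    by_cases h : m = i
    · subst h; simp [hi, center]; ring
    · simp [h]
  by_cases hk : k a.1.1.1 = a.2
  · by_cases him : i = a.1.1.2
    · rw [if_pos ⟨hk, him⟩]
      have hci := hc i
      rw [if_pos rfl, Function.update_self] at hci
      simp [faceMid, altFun, hk, linPoly, ← him, hci]
      field_simp [hs i]
    · rw [if_neg fun h => him h.2]
      simp [faceMid, altFun, hk, linPoly, Ne.symm him]
  · rw [if_neg fun h => hk h.1]
    simp [faceMid, altFun, hk]

theorem altFun_mem_Vper {ℓ : Fin 3 → ℝ} (hℓ : ∀ i, 0 < ℓ i) {N : Fin 3 → ℕ}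
    [∀ i, NeZero (N i)] (hN : ∀ i, Even (N i)) (a : AltIdx N) : altFun ℓ N a ∈ Vper ℓ N := by
  have key : ∀ (i : Fin 3) (k : Cell N), faceAvg ℓ N k i (hi ℓ N k i) (altFun ℓ N a k) =
      faceAvg ℓ N (nextCell i k) i (lo ℓ N (nextCell i k) i)
        (altFun ℓ N a (nextCell i k)) := by
    intro i k
    rw [faceAvg_eq_faceMid hℓ, faceAvg_eq_faceMid hℓ, faceMid_altFun_hi hℓ,
      faceMid_altFun_lo hℓ]
    by_cases hi : i = a.1.1.2
    · have hne : a.1.1.1 ≠ i := by rw [hi]; exact a.1.2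
      have hmem : i ∈ Finset.univ.erase a.1.1.1 := by simp [hne.symm]
      refine if_congr (by simp [nextCell, hne]) ?_ rfl
      rw [← Finset.add_sum_erase _ _ hmem, ← Finset.add_sum_erase _ _ hmem, pow_add, pow_add]
      have h1 : ∑ m ∈ (Finset.univ.erase a.1.1.1).erase i, ((nextCell i k m : Fin (N m)) : ℕ) =
          ∑ m ∈ (Finset.univ.erase a.1.1.1).erase i, (k m : ℕ) := by
        refine Finset.sum_congr rfl fun m hm => ?_
        simp [nextCell, Finset.ne_of_mem_erase hm]
      have h2 : ((-1 : ℝ)) ^ ((nextCell i k i : Fin (N i)) : ℕ) = -(-1) ^ (k i : ℕ) := by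
        simp only [nextCell, Function.update_self]
        exact neg_one_pow_add_one (hN i) (k i)
      rw [h1, h2]
      ring
    · rw [if_neg fun h => hi h.2, if_neg fun h => hi h.2]
  exact ⟨fun i k _ => key i k, fun i k _ => key i k⟩

/-- The subspace of those functions of `V^h_#` that lie in the span of the node-based functions. -/
def VB (ℓ : Fin 3 → ℝ) (N : Fin 3 → ℕ) [∀ i, NeZero (N i)] : Submodule ℝ (BrokenP1 N) :=
  Vper ℓ N ⊓ Submodule.span ℝ (Set.range (nodeFun ℓ N))

/-- `Bf` selects node-based functions that form a basis of `VB`. -/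
def IsNodeBasis (ℓ : Fin 3 → ℝ) (N : Fin 3 → ℕ) [∀ i, NeZero (N i)]
    (Bf : Finset (Node N)) : Prop :=
  LinearIndependent ℝ (fun z : Bf => nodeFun ℓ N z) ∧
    Submodule.span ℝ (Set.range fun z : Bf => nodeFun ℓ N z) = VB ℓ N

/-- `Af` selects, for every direction `μ`, all but one of the alternating functions with
subscript `μ`, that is, `∑_{ι ≠ μ} N ι - 1` of them. -/
def IsAltSelection (N : Fin 3 → ℕ) (Af : Finset (AltIdx N)) : Prop :=
  ∀ μ : Fin 3, (Af.filter fun a => a.1.1.2 = μ).card + 1 = ∑ ι ∈ Finset.univ.erase μ, N ι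

/-! ### Linear systems -/

/-- The stiffness matrix of a family of functions. -/
def stiffness (ℓ : Fin 3 → ℝ) {N : Fin 3 → ℕ} {I : Type} (b : I → BrokenP1 N) : Matrix I I ℝ :=
  Matrix.of fun j k => energy ℓ (b k) (b j)

/-- The load vector `∫_Ω f b_j`. -/
def load (ℓ : Fin 3 → ℝ) {N : Fin 3 → ℕ} {I : Type} (f : (Fin 3 → ℝ) → ℝ)
    (b : I → BrokenP1 N) : I → ℝ :=
  fun j => ∫ x in Omega ℓ, f x * toFunc ℓ (b j) x

/-- The function with coefficient vector `c` with respect to the family `b`. -/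
def comb {N : Fin 3 → ℕ} {I : Type} [Fintype I] (b : I → BrokenP1 N) (c : I → ℝ) : BrokenP1 N :=
  ∑ j, c j • b j

/-- The family consisting of the node-based functions `φ` followed by the alternating
functions `ψ`. -/
def joined {N : Fin 3 → ℕ} {I J : Type} (φ : I → BrokenP1 N) (ψ : J → BrokenP1 N) :
    I ⊕ J → BrokenP1 N :=
  Sum.elim φ ψ

/-- `last` is an admissible last index of the basis `Bf`: in the expansion of the constant
function `1` in this basis its coefficient does not vanish. -/
def IsAdmissibleLast (ℓ : Fin 3 → ℝ) (N : Fin 3 → ℕ) [∀ i, NeZero (N i)]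
    (Bf : Finset (Node N)) (last : Bf) : Prop :=
  ∃ w : Bf → ℝ, comb (fun z : Bf => nodeFun ℓ N z) w = (fun _ => AffineMap.const ℝ _ 1) ∧
    w last ≠ 0

/-- Option 1: the block diagonal system in which the row `last` of the stiffness matrix of `φ` is
replaced by ones and the entry `last` of the load vector by zero. -/
def Solves1 (ℓ : Fin 3 → ℝ) {N : Fin 3 → ℕ} {I J : Type} [Fintype I] [Fintype J] [DecidableEq I]
    (f : (Fin 3 → ℝ) → ℝ) (φ : I → BrokenP1 N) (ψ : J → BrokenP1 N) (last : I)
    (u : I ⊕ J → ℝ) : Prop :=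
  (Matrix.fromBlocks ((stiffness ℓ φ).updateRow last fun _ => 1) 0 0 (stiffness ℓ ψ)).mulVec u =
    Sum.elim (Function.update (load ℓ f φ) last 0) (load ℓ f ψ)

/-- Options 2 and 3: the unmodified block diagonal system together with the zero mean condition
on the coefficients of the node-based functions. -/
def Solves23 (ℓ : Fin 3 → ℝ) {N : Fin 3 → ℕ} {I J : Type} [Fintype I] [Fintype J]
    (f : (Fin 3 → ℝ) → ℝ) (φ : I → BrokenP1 N) (ψ : J → BrokenP1 N) (u : I ⊕ J → ℝ) : Prop :=
  (Matrix.fromBlocks (stiffness ℓ φ) 0 0 (stiffness ℓ ψ)).mulVec u =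
      Sum.elim (load ℓ f φ) (load ℓ f ψ) ∧
    ∑ j, u (Sum.inl j) = 0

/-- The Krylov space `span {r, A r, A² r, …}`. -/
def krylov {I : Type} [Fintype I] [DecidableEq I] (A : Matrix I I ℝ) (r : I → ℝ) :
    Submodule ℝ (I → ℝ) :=
  Submodule.span ℝ (Set.range fun n : ℕ => (A ^ n).mulVec r)

/-- Option 4: `u` is a Krylov solution, with initial vector `u₀`, of the system associated with
the functions `φ` alone. -/
def Solves4 (ℓ : Fin 3 → ℝ) {N : Fin 3 → ℕ} {I : Type} [Fintype I] [DecidableEq I]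
    (f : (Fin 3 → ℝ) → ℝ) (φ : I → BrokenP1 N) (u₀ u : I → ℝ) : Prop :=
  (stiffness ℓ φ).mulVec u = load ℓ f φ ∧
    u - u₀ ∈ krylov (stiffness ℓ φ) (load ℓ f φ - (stiffness ℓ φ).mulVec u₀)

end P1NC

end

noncomputable section

namespace P1NC

/-! ### Symmetric linear systems -/

section LinearAlgebra

variable {I : Type} [Fintype I]

/-! The system matrices are block diagonal by definition, so each solution is the sum of a node part
and an alternating part, found independently; orthogonality of the two families is never needed.
Each part is a Galerkin solution in the span of its family (`isGalerkin_comb`), so it depends on the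
span and a normalization, not on the chosen generators.

Node part. On `Vper` zero energy forces a constant (`eq_smul_one_of_energy_eq_zero`), so Galerkin
solutions differ by constants. Every node function has the same sum of cell barycenter values, so
the coefficient sum is a multiple of a functional of the represented function (`cellSum_comb`): the
zero-sum condition picks the same function for `Bf` and for the full family. All node functions
together add up to the constant 2, so the all-ones vector lies in the kernel of the full stiffness
matrix. It is orthogonal to the load because `f` has mean zero, and Krylov iterates therefore keep
their coefficient sum (`sum_eq_zero_of_solves4`). In the modified system the replaced equation
follows from the remaining ones, because the coefficients of 1 form a kernel vector that is nonzero
in that row (`updateRow_mulVec_eq_iff`).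

Alternating part. These functions vanish at cell barycenters, so the energy is definite on their
span. For each subscript they satisfy, up to scaling, exactly one linear relation, and none of its
coefficients vanishes. Dropping any one function thus leaves a basis of the same span
(`comb_altFun_subtype_eq_zero`, `span_altSelection`).

Estimates. The third and fourth solutions have the same node part and differ by the alternating part
`v` alone. Since `v` vanishes at barycenters, a cellwise Poincaré inequality bounds its L² norm by
`h` times its energy norm; testing its Galerkin equation with `v` then gives both bounds, with
constant 1. -/

theorem dotProduct_mulVec_comm {A : Matrix I I ℝ} (hA : A.IsSymm) (u v : I → ℝ) :
    u ⬝ᵥ A.mulVec v = A.mulVec u ⬝ᵥ v := by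
  rw [Matrix.dotProduct_mulVec, ← Matrix.mulVec_transpose, hA.eq]

/-- For a symmetric matrix the range is orthogonal to the kernel, so `x` is orthogonal to itself. -/
theorem eq_zero_of_mem_range_of_mulVec_eq_zero {A : Matrix I I ℝ} (hA : A.IsSymm) {x : I → ℝ}
    (hx : x ∈ LinearMap.range A.mulVecLin) (h0 : A.mulVec x = 0) : x = 0 := by
  obtain ⟨y, rfl⟩ := hx
  rw [← dotProduct_self_eq_zero]
  conv_lhs => rw [Matrix.mulVecLin_apply, dotProduct_mulVec_comm hA]
  rw [Matrix.mulVecLin_apply] at h0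
  rw [h0, zero_dotProduct]

variable [DecidableEq I]

/-- Fredholm alternative: a functional that separates `b` from the range is represented by a vector
which, by symmetry, lies in the kernel. -/
theorem exists_mulVec_eq_of_isSymm {A : Matrix I I ℝ} (hA : A.IsSymm) (b : I → ℝ)
    (hb : ∀ c, A.mulVec c = 0 → c ⬝ᵥ b = 0) : ∃ u, A.mulVec u = b := by
  by_contra hne
  have hmem : b ∉ LinearMap.range A.mulVecLin := fun ⟨u, hu⟩ => hne ⟨u, hu⟩
  obtain ⟨f, hfb, hf⟩ := Submodule.exists_le_ker_of_notMem hmem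
  have hfc : ∀ v, f v = (fun i => f (Pi.single i 1)) ⬝ᵥ v := by
    intro v
    conv_lhs => rw [pi_eq_sum_univ' v]
    simp [dotProduct, mul_comm, Pi.single]
  refine hfb ?_
  rw [hfc]
  refine hb _ (dotProduct_eq_zero _ fun u => ?_)
  rw [← dotProduct_mulVec_comm hA, ← hfc]
  exact hf ⟨u, rfl⟩

theorem existsUnique_mulVec_eq {A : Matrix I I ℝ} (hA : ∀ c, A.mulVec c = 0 → c = 0)
    (b : I → ℝ) : ∃! u, A.mulVec u = b := by
  have hinj : Function.Injective A.mulVec :=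
    (injective_iff_map_eq_zero A.mulVecLin).2 hA
  obtain ⟨u, hu⟩ :=
    Matrix.mulVec_surjective_iff_isUnit.2 (Matrix.mulVec_injective_iff_isUnit.1 hinj) b
  exact ⟨u, hu, fun v hv => hinj (hv.trans hu.symm)⟩

/-! ### Krylov spaces. -/

theorem mulVec_mem_krylov {A : Matrix I I ℝ} {r x : I → ℝ} (hx : x ∈ krylov A r) :
    A.mulVec x ∈ krylov A r := by
  induction hx using Submodule.span_induction with
  | mem x hx =>
    obtain ⟨n, rfl⟩ := hx
    refine Submodule.subset_span ⟨n + 1, ?_⟩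
    simp [pow_succ', Matrix.mulVec_mulVec]
  | zero => simp
  | add x y _ _ hx hy => rw [Matrix.mulVec_add]; exact add_mem hx hy
  | smul a x _ hx => rw [Matrix.mulVec_smul]; exact Submodule.smul_mem _ _ hx

theorem krylov_le_range {A : Matrix I I ℝ} {y : I → ℝ} :
    krylov A (A.mulVec y) ≤ LinearMap.range A.mulVecLin := by
  refine Submodule.span_le.2 ?_
  rintro _ ⟨n, rfl⟩
  refine ⟨(A ^ n).mulVec y, ?_⟩
  simp only [Matrix.mulVecLin_apply, Matrix.mulVec_mulVec]
  rw [← pow_succ, ← pow_succ']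

/-- Consistency puts the initial residual, hence the whole Krylov space, into the range of `A`,
where `A` has trivial kernel. So `A` restricts to an injective, hence bijective, endomorphism of the
Krylov space, and the correction is the preimage of the residual. -/
theorem existsUnique_krylov_solution {A : Matrix I I ℝ} (hA : A.IsSymm) {b : I → ℝ}
    (hb : ∃ u, A.mulVec u = b) (u₀ : I → ℝ) :
    ∃! u, A.mulVec u = b ∧ u - u₀ ∈ krylov A (b - A.mulVec u₀) := by
  obtain ⟨y, rfl⟩ := hb
  have hr : A.mulVec y - A.mulVec u₀ = A.mulVec (y - u₀) := (Matrix.mulVec_sub _ _ _).symm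
  rw [hr]
  set K := krylov A (A.mulVec (y - u₀)) with hK
  have hzero : ∀ x ∈ K, A.mulVec x = 0 → x = 0 := fun x hx h0 =>
    eq_zero_of_mem_range_of_mulVec_eq_zero hA (krylov_le_range hx) h0
  let g : K →ₗ[ℝ] K := A.mulVecLin.restrict fun x hx => mulVec_mem_krylov hx
  have hg : Function.Injective g := by
    refine (injective_iff_map_eq_zero g).2 fun x hx => ?_
    exact Subtype.ext (hzero x x.2 (congrArg Subtype.val hx))
  have hmem : A.mulVec (y - u₀) ∈ K := Submodule.subset_span ⟨0, by simp⟩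
  obtain ⟨x, hx⟩ := LinearMap.injective_iff_surjective.1 hg ⟨_, hmem⟩
  have hx' : A.mulVec (x : I → ℝ) = A.mulVec (y - u₀) := congrArg Subtype.val hx
  refine ⟨u₀ + x, ⟨?_, ?_⟩, ?_⟩
  · rw [Matrix.mulVec_add, hx', ← Matrix.mulVec_add, add_sub_cancel]
  · rw [add_sub_cancel_left]; exact x.2
  · rintro v ⟨hv, hvK⟩
    have h1 : v - u₀ - x = 0 := by
      refine hzero _ (sub_mem hvK x.2) ?_
      rw [Matrix.mulVec_sub, hx', Matrix.mulVec_sub, hv, Matrix.mulVec_sub, sub_self]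
    rw [← sub_eq_zero, ← h1]; abel

/-- By symmetry a kernel vector is orthogonal to every `A ^ (n + 1)` image, so only the generator
`r` itself needs a hypothesis. -/
theorem dotProduct_eq_zero_of_mem_krylov {A : Matrix I I ℝ} (hA : A.IsSymm) {r c x : I → ℝ}
    (hc : A.mulVec c = 0) (hr : c ⬝ᵥ r = 0) (hx : x ∈ krylov A r) : c ⬝ᵥ x = 0 := by
  induction hx using Submodule.span_induction with
  | mem x hx =>
    obtain ⟨n, rfl⟩ := hx
    cases n with
    | zero => simpa using hr
    | succ n =>
      change c ⬝ᵥ (A ^ (n + 1)).mulVec r = 0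
      rw [pow_succ', ← Matrix.mulVec_mulVec, dotProduct_mulVec_comm hA, hc, zero_dotProduct]
  | zero => simp
  | add x y _ _ hx hy => rw [dotProduct_add, hx, hy, add_zero]
  | smul a x _ hx => rw [dotProduct_smul, hx, smul_zero]

end LinearAlgebra

/-! ### Combinations and linear polynomials -/

section

variable {N : Fin 3 → ℕ}

theorem comb_mem_span {I : Type} [Fintype I] (b : I → BrokenP1 N) (c : I → ℝ) :
    comb b c ∈ Submodule.span ℝ (Set.range b) :=
  Submodule.sum_mem _ fun j _ => Submodule.smul_mem _ _ (Submodule.subset_span ⟨j, rfl⟩)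

theorem comb_joined {I J : Type} [Fintype I] [Fintype J] (φ : I → BrokenP1 N)
    (ψ : J → BrokenP1 N) (u : I ⊕ J → ℝ) :
    comb (joined φ ψ) u = comb φ (u ∘ Sum.inl) + comb ψ (u ∘ Sum.inr) := by
  simp [comb, joined]

theorem map_comb {I : Type} [Fintype I] (L : BrokenP1 N →ₗ[ℝ] ℝ) (b : I → BrokenP1 N)
    (c : I → ℝ) : L (comb b c) = ∑ j, c j * L (b j) := by
  simp [comb]

/-- Evaluation of the piece on the cell `k` at the point `x`. -/
def evalAt (k : Cell N) (x : Fin 3 → ℝ) : BrokenP1 N →ₗ[ℝ] ℝ where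
  toFun v := v k x
  map_add' _ _ := rfl
  map_smul' _ _ := rfl

/-- The partial derivative of the piece on the cell `k`. -/
def derivAt (k : Cell N) (i : Fin 3) : BrokenP1 N →ₗ[ℝ] ℝ where
  toFun v := partialDeriv i (v k)
  map_add' _ _ := rfl
  map_smul' _ _ := rfl

theorem apply_eq_taylor (p : (Fin 3 → ℝ) →ᵃ[ℝ] ℝ) (c x : Fin 3 → ℝ) :
    p x = p c + ∑ i, partialDeriv i p * (x i - c i) := by
  have h : p x = p.linear (x - c) + p c := by
    have := p.map_vadd c (x - c)
    simpa using this
  rw [h, LinearMap.pi_apply_eq_sum_univ p.linear (x - c), add_comm]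
  congr 1
  refine Finset.sum_congr rfl fun i _ => ?_
  have : (fun j => if i = j then (1 : ℝ) else 0) = Pi.single i 1 := by
    ext j; simp [Pi.single_apply, eq_comm]
  rw [this, smul_eq_mul, Pi.sub_apply, mul_comm, partialDeriv]

theorem partialDeriv_linPoly (c : Fin 3 → ℝ) (a : ℝ) (g : Fin 3 → ℝ) (i : Fin 3) :
    partialDeriv i (linPoly c a g) = g i := by
  simp [partialDeriv, linPoly, Pi.single_apply]

theorem linPoly_center (c : Fin 3 → ℝ) (a : ℝ) (g : Fin 3 → ℝ) : linPoly c a g c = a := by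
  simp [linPoly]

/-- A linear polynomial is determined by its gradient and its value at one point; the point may be
chosen per cell. -/
theorem brokenP1_ext {v w : BrokenP1 N} (x : Cell N → Fin 3 → ℝ)
    (h0 : ∀ k, evalAt k (x k) v = evalAt k (x k) w)
    (h1 : ∀ k i, derivAt k i v = derivAt k i w) : v = w := by
  refine funext fun k => AffineMap.ext fun y => ?_
  rw [apply_eq_taylor (v k) (x k), apply_eq_taylor (w k) (x k)]
  congr 1
  · exact h0 k
  · exact Finset.sum_congr rfl fun i _ => by rw [show partialDeriv i (v k) = _ from h1 k i]; rfl

end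

/-! ### The energy form -/

section Energy

variable {ℓ : Fin 3 → ℝ} {N : Fin 3 → ℕ}

/-- The volume of a cell. -/
def cellVol (ℓ : Fin 3 → ℝ) (N : Fin 3 → ℕ) : ℝ := ∏ i, step ℓ N i

theorem hi_sub_lo (k : Cell N) (i : Fin 3) : hi ℓ N k i - lo ℓ N k i = step ℓ N i := by
  simp only [hi, lo]; ring

theorem volume_real_cellSet [∀ i, NeZero (N i)] (hℓ : ∀ i, 0 < ℓ i) (k : Cell N) :
    volume.real (cellSet ℓ N k) = cellVol ℓ N := by
  rw [Measure.real, cellSet, Real.volume_pi_Ioo_toReal]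
  · simp only [hi_sub_lo]; rfl
  · intro i
    have := step_pos hℓ N i
    have := hi_sub_lo (ℓ := ℓ) k i
    linarith

theorem cellVol_pos [∀ i, NeZero (N i)] (hℓ : ∀ i, 0 < ℓ i) : 0 < cellVol ℓ N :=
  Finset.prod_pos fun i _ => step_pos hℓ N i

theorem energy_eq [∀ i, NeZero (N i)] (hℓ : ∀ i, 0 < ℓ i) (u v : BrokenP1 N) :
    energy ℓ u v = cellVol ℓ N * ∑ k, ∑ i, derivAt k i u * derivAt k i v := by
  simp only [energy, setIntegral_const, volume_real_cellSet hℓ, smul_eq_mul, ← Finset.mul_sum]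
  rfl

theorem energy_comm (u v : BrokenP1 N) : energy ℓ u v = energy ℓ v u := by
  simp only [energy, mul_comm]

/-- The linear functional `a_h(·, v)`. -/
def energyLeft (ℓ : Fin 3 → ℝ) (N : Fin 3 → ℕ) (v : BrokenP1 N) : BrokenP1 N →ₗ[ℝ] ℝ :=
  cellVol ℓ N • ∑ k, ∑ i, derivAt k i v • derivAt k i

/-- Makes the linearity of the explicit formula available for `energy`, sparing every integrability
argument. -/
theorem energyLeft_apply [∀ i, NeZero (N i)] (hℓ : ∀ i, 0 < ℓ i) (u v : BrokenP1 N) :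
    energyLeft ℓ N v u = energy ℓ u v := by
  simp [energy_eq hℓ, energyLeft, mul_comm]

theorem stiffness_mulVec [∀ i, NeZero (N i)] (hℓ : ∀ i, 0 < ℓ i) {I : Type} [Fintype I]
    (b : I → BrokenP1 N) (c : I → ℝ) (j : I) :
    (stiffness ℓ b).mulVec c j = energy ℓ (comb b c) (b j) := by
  rw [← energyLeft_apply hℓ, map_comb]
  simp [Matrix.mulVec, dotProduct, stiffness, energyLeft_apply hℓ, mul_comm]

theorem stiffness_isSymm {I : Type} (b : I → BrokenP1 N) : (stiffness ℓ b).IsSymm := by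
  ext i j
  simp [stiffness, energy_comm]

theorem derivAt_eq_zero_of_energy [∀ i, NeZero (N i)] (hℓ : ∀ i, 0 < ℓ i) {v : BrokenP1 N}
    (h : energy ℓ v v = 0) (k : Cell N) (i : Fin 3) : derivAt k i v = 0 := by
  rw [energy_eq hℓ, mul_eq_zero, or_iff_right (cellVol_pos hℓ).ne'] at h
  rw [Finset.sum_eq_zero_iff_of_nonneg
    fun _ _ => Finset.sum_nonneg fun _ _ => mul_self_nonneg _] at h
  have h2 := (Finset.sum_eq_zero_iff_of_nonneg fun _ _ => mul_self_nonneg _).1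
    (h k (Finset.mem_univ _)) i (Finset.mem_univ _)
  exact mul_self_eq_zero.1 h2

theorem energy_comb_eq_zero [∀ i, NeZero (N i)] (hℓ : ∀ i, 0 < ℓ i) {I : Type} [Fintype I]
    (b : I → BrokenP1 N) (v : BrokenP1 N) (h : ∀ j, energy ℓ v (b j) = 0) (w : BrokenP1 N)
    (hw : w ∈ Submodule.span ℝ (Set.range b)) : energy ℓ v w = 0 := by
  rw [energy_comm, ← energyLeft_apply hℓ]
  refine (Submodule.span_le (p := LinearMap.ker (energyLeft ℓ N v))).2 ?_ hw
  rintro _ ⟨j, rfl⟩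
  simp [energyLeft_apply hℓ, energy_comm, h j]

end Energy

/-! ### Node-based functions -/

section Node

variable {ℓ : Fin 3 → ℝ} {N : Fin 3 → ℕ}

/-- Values and slopes of node functions are products of one-dimensional factors, so their sums over
the mesh factor as well. -/
theorem sum_prod_eq (g : (i : Fin 3) → Fin (N i) → ℝ) :
    ∑ z : (i : Fin 3) → Fin (N i), ∏ i, g i (z i) = ∏ i, ∑ a, g i a := by
  rw [Finset.prod_univ_sum, Fintype.piFinset_univ]

/-- The constant function `1`. -/
def one (N : Fin 3 → ℕ) : BrokenP1 N := fun _ => AffineMap.const ℝ _ 1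

theorem evalAt_one (k : Cell N) (x : Fin 3 → ℝ) : evalAt k x (one N) = 1 := rfl

theorem derivAt_one (k : Cell N) (i : Fin 3) : derivAt k i (one N) = 0 := by
  simp [derivAt, one, partialDeriv]

/-- A one-dimensional cell has two end nodes; evenness gives `n ≥ 2`, so periodic identification
does not merge them. -/
theorem sum_ite_succ_left {n : ℕ} [NeZero n] (hn : Even n) (a : Fin n) :
    ∑ z : Fin n, (if z = a ∨ z = a + 1 then (1 : ℝ) else 0) = 2 := by
  have h : ∀ z : Fin n, (if z = a ∨ z = a + 1 then (1 : ℝ) else 0) =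
      (if z = a then 1 else 0) + (if z = a + 1 then 1 else 0) := by
    intro z
    have := fin_ne_add_one hn a
    split_ifs <;> simp_all
  simp only [h, Finset.sum_add_distrib, Finset.sum_ite_eq', Finset.mem_univ, if_true]
  norm_num

theorem sum_ite_succ_right {n : ℕ} [NeZero n] (hn : Even n) (z : Fin n) :
    ∑ a : Fin n, (if z = a ∨ z = a + 1 then (1 : ℝ) else 0) = 2 := by
  have h : ∀ a : Fin n, (if z = a ∨ z = a + 1 then (1 : ℝ) else 0) =
      (if z = a then 1 else 0) + (if z - 1 = a then 1 else 0) := by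
    intro a
    have := fin_ne_add_one hn a
    simp only [sub_eq_iff_eq_add]
    split_ifs <;> simp_all
  simp only [h, Finset.sum_add_distrib, Finset.sum_ite_eq, Finset.mem_univ, if_true]
  norm_num

theorem sum_sign_succ {n : ℕ} [NeZero n] (hn : Even n) (a : Fin n) :
    ∑ z : Fin n, (if z = a ∨ z = a + 1 then (if z = a + 1 then (1 : ℝ) else -1) else 0) = 0 := by
  have h : ∀ z : Fin n, (if z = a ∨ z = a + 1 then (if z = a + 1 then (1 : ℝ) else -1) else 0) =
      (if z = a + 1 then 1 else 0) - (if z = a then 1 else 0) := by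
    intro z
    have := fin_ne_add_one hn a
    split_ifs <;> simp_all
  simp only [h, Finset.sum_sub_distrib, Finset.sum_ite_eq', Finset.mem_univ, if_true]
  norm_num

variable [∀ i, NeZero (N i)]

theorem evalAt_nodeFun (z : Node N) (k : Cell N) :
    evalAt k (center ℓ N k) (nodeFun ℓ N z) =
      1 / 4 * ∏ i, (if z i = k i ∨ z i = k i + 1 then (1 : ℝ) else 0) := by
  rw [Finset.prod_boole]
  change nodeFun ℓ N z k (center ℓ N k) = _
  by_cases h : ∀ i, z i = k i ∨ z i = k i + 1
  · simp [nodeFun, h, linPoly_center]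
  · simp [nodeFun, h]

theorem derivAt_nodeFun (z : Node N) (k : Cell N) (i : Fin 3) :
    derivAt k i (nodeFun ℓ N z) =
      1 / (2 * step ℓ N i) * ∏ m, (if z m = k m ∨ z m = k m + 1 then
        (if m = i then (if z m = k m + 1 then (1 : ℝ) else -1) else 1) else 0) := by
  change partialDeriv i (nodeFun ℓ N z k) = _
  by_cases h : ∀ i, z i = k i ∨ z i = k i + 1
  · simp only [nodeFun, h, implies_true, if_true, partialDeriv_linPoly, Finset.prod_ite_eq',
      Finset.mem_univ]
    ring
  · obtain ⟨m, hm⟩ := not_forall.1 h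
    rw [Finset.prod_eq_zero (Finset.mem_univ m) (if_neg hm)]
    simp only [nodeFun, h, if_false, mul_zero]
    rfl

/-- Each cell has eight vertices contributing 1/4 at its barycenter, and the slopes from opposite
ends cancel. -/
theorem comb_nodeFun_one (hN : ∀ i, Even (N i)) :
    comb (nodeFun ℓ N) (fun _ => 1) = (2 : ℝ) • one N := by
  refine brokenP1_ext (center ℓ N) (fun k => ?_) fun k i => ?_
  · rw [map_comb, map_smul, evalAt_one]
    simp only [evalAt_nodeFun, one_mul, ← Finset.mul_sum]
    rw [sum_prod_eq fun i a => if a = k i ∨ a = k i + 1 then (1 : ℝ) else 0]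
    simp only [sum_ite_succ_left (hN _), Fin.prod_univ_three, smul_eq_mul]
    norm_num
  · rw [map_comb, map_smul, derivAt_one]
    simp only [derivAt_nodeFun, one_mul, ← Finset.mul_sum]
    rw [sum_prod_eq fun m a => if a = k m ∨ a = k m + 1 then
        (if m = i then (if a = k m + 1 then (1 : ℝ) else -1) else 1) else 0,
      Finset.prod_eq_zero (Finset.mem_univ i)]
    · simp
    · simpa using sum_sign_succ (hN i) (k i)

/-- The sum of the values at the barycenters of the cells. -/
def cellSum (ℓ : Fin 3 → ℝ) (N : Fin 3 → ℕ) : BrokenP1 N →ₗ[ℝ] ℝ :=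
  ∑ k, evalAt k (center ℓ N k)

/-- Periodically, each node belongs to eight cells, with barycenter value 1/4 in each. -/
theorem cellSum_nodeFun (hN : ∀ i, Even (N i)) (z : Node N) :
    cellSum ℓ N (nodeFun ℓ N z) = 2 := by
  simp only [cellSum, LinearMap.sum_apply, evalAt_nodeFun, ← Finset.mul_sum]
  rw [sum_prod_eq fun i a => if z i = a ∨ z i = a + 1 then (1 : ℝ) else 0]
  simp only [sum_ite_succ_right (hN _), Fin.prod_univ_three]
  norm_num

theorem cellSum_one_ne_zero : cellSum ℓ N (one N) ≠ 0 := by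
  simp only [cellSum, LinearMap.sum_apply, evalAt_one, Finset.sum_const, nsmul_eq_mul, mul_one]
  exact Nat.cast_ne_zero.2 Finset.univ_nonempty.card_pos.ne'

/-! ### Rigidity: functions of zero energy. -/

theorem const_of_nextCell {α : Type} (g : Cell N → α) (h : ∀ i k, g (nextCell i k) = g k)
    (k : Cell N) : g k = g fun _ => 0 := by
  have hupd : ∀ (i : Fin 3) (n : ℕ) (k : Cell N),
      g (Function.update k i (Fin.ofNat (N i) n)) = g (Function.update k i 0) := by
    intro i n k
    induction n with
    | zero => rfl
    | succ n ih =>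
      rw [← ih, ← h i (Function.update k i (Fin.ofNat (N i) n))]
      congr 1
      simp only [nextCell, Function.update_self, Function.update_idem]
      congr 1
      ext
      simp [Fin.val_add]
  have hzero : ∀ (i : Fin 3) (k : Cell N), g k = g (Function.update k i 0) := by
    intro i k
    rw [← hupd i (k i) k]
    congr 1
    simp
  rw [hzero 0, hzero 1, hzero 2]
  congr 1
  funext i
  fin_cases i <;> simp

/-- Zero energy makes every piece constant; equality of face averages then identifies the constants
of neighbouring cells. -/
theorem eq_smul_one_of_energy_eq_zero (hℓ : ∀ i, 0 < ℓ i) {v : BrokenP1 N} (hv : v ∈ Vper ℓ N)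
    (h0 : energy ℓ v v = 0) : ∃ t : ℝ, v = t • one N := by
  have hval : ∀ k x, v k x = v k 0 := by
    intro k x
    rw [apply_eq_taylor (v k) 0 x, Finset.sum_eq_zero, add_zero]
    intro i _
    rw [show partialDeriv i (v k) = 0 from derivAt_eq_zero_of_energy hℓ h0 k i, zero_mul]
  -- The interior and the periodic conditions together form one condition for every cell, valid
  -- across the wrap-around.
  have hface : ∀ i k, faceAvg ℓ N k i (hi ℓ N k i) (v k) =
      faceAvg ℓ N (nextCell i k) i (lo ℓ N (nextCell i k) i) (v (nextCell i k)) := by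
    intro i k
    rcases Nat.lt_or_ge ((k i : ℕ) + 1) (N i) with h | h
    · exact hv.1 i k h
    · exact hv.2 i k (le_antisymm (k i).2 h)
  have hnext : ∀ i k, v (nextCell i k) 0 = v k 0 := by
    intro i k
    have := hface i k
    rw [faceAvg_eq_faceMid hℓ, faceAvg_eq_faceMid hℓ, faceMid, faceMid, hval,
      hval (nextCell i k)] at this
    exact this.symm
  refine ⟨v (fun _ => 0) 0, brokenP1_ext (fun _ => 0) (fun k => ?_) fun k i => ?_⟩
  · rw [map_smul, evalAt_one]
    rw [smul_eq_mul, mul_one]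
    exact const_of_nextCell (fun k => v k 0) hnext k
  · rw [map_smul, derivAt_one, derivAt_eq_zero_of_energy hℓ h0, smul_zero]

theorem energy_one (hℓ : ∀ i, 0 < ℓ i) (v : BrokenP1 N) : energy ℓ (one N) v = 0 := by
  simp [energy_eq hℓ, derivAt_one]

/-- A function of `V^h_#` with vanishing energy and vanishing sum of barycenter values is zero. -/
theorem eq_zero_of_energy_of_cellSum (hℓ : ∀ i, 0 < ℓ i) {v : BrokenP1 N} (hv : v ∈ Vper ℓ N)
    (h0 : energy ℓ v v = 0) (hs : cellSum ℓ N v = 0) : v = 0 := by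
  obtain ⟨t, rfl⟩ := eq_smul_one_of_energy_eq_zero hℓ hv h0
  rw [map_smul, smul_eq_mul, mul_eq_zero, or_iff_left cellSum_one_ne_zero] at hs
  rw [hs, zero_smul]

/-- The coefficient sum depends only on the represented function, whichever subfamily of node
functions is used. This makes the zero-sum normalizations comparable. -/
theorem cellSum_comb (hN : ∀ i, Even (N i)) {I : Type} [Fintype I] (b : I → Node N)
    (c : I → ℝ) : cellSum ℓ N (comb (fun j => nodeFun ℓ N (b j)) c) = 2 * ∑ j, c j := by
  rw [map_comb]
  simp only [cellSum_nodeFun hN, ← Finset.sum_mul, mul_comm]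

theorem comb_nodeFun_mem_Vper (hℓ : ∀ i, 0 < ℓ i) (hN : ∀ i, Even (N i)) {I : Type} [Fintype I]
    (b : I → Node N) (c : I → ℝ) : comb (fun j => nodeFun ℓ N (b j)) c ∈ Vper ℓ N :=
  Submodule.sum_mem _ fun _ _ => Submodule.smul_mem _ _ (nodeFun_mem_Vper hℓ hN _)

theorem span_nodeBasis (hℓ : ∀ i, 0 < ℓ i) (hN : ∀ i, Even (N i)) {Bf : Finset (Node N)}
    (hB : IsNodeBasis ℓ N Bf) : Submodule.span ℝ (Set.range fun z : Bf => nodeFun ℓ N z) =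
      Submodule.span ℝ (Set.range (nodeFun ℓ N)) := by
  rw [hB.2, VB, inf_eq_right, Submodule.span_le]
  rintro _ ⟨z, rfl⟩
  exact nodeFun_mem_Vper hℓ hN z

theorem one_mem_span (hN : ∀ i, Even (N i)) :
    one N ∈ Submodule.span ℝ (Set.range (nodeFun ℓ N)) := by
  have h := comb_mem_span (nodeFun ℓ N) fun _ => 1
  rw [comb_nodeFun_one hN] at h
  exact (Submodule.smul_mem_iff _ two_ne_zero).1 h

end Node

/-! ### Alternating functions -/

section Alt

variable {ℓ : Fin 3 → ℝ} {N : Fin 3 → ℕ}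

theorem evalAt_altFun (a : AltIdx N) (k : Cell N) :
    evalAt k (center ℓ N k) (altFun ℓ N a) = 0 := by
  change altFun ℓ N a k (center ℓ N k) = _
  by_cases h : k a.1.1.1 = a.2
  · simp [altFun, h, linPoly_center]
  · simp [altFun, h]

theorem evalAt_comb_altFun {I : Type} [Fintype I] (b : I → AltIdx N) (c : I → ℝ) (k : Cell N) :
    evalAt k (center ℓ N k) (comb (fun j => altFun ℓ N (b j)) c) = 0 := by
  simp [map_comb, evalAt_altFun]

/-- On the layer the two signs in direction ι cancel. Writing the slope this way isolates the
checkerboard sign of the cell, common to all alternating functions. -/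
theorem derivAt_altFun (a : AltIdx N) (k : Cell N) (i : Fin 3) :
    derivAt k i (altFun ℓ N a) = if k a.1.1.1 = a.2 ∧ i = a.1.1.2 then
      -2 * (-1) ^ (∑ m, (k m : ℕ)) / step ℓ N i * (-1) ^ (a.2 : ℕ) else 0 := by
  change partialDeriv i (altFun ℓ N a k) = _
  by_cases h : k a.1.1.1 = a.2
  · by_cases hi : i = a.1.1.2
    · rw [if_pos ⟨h, hi⟩, ← Finset.add_sum_erase _ _ (Finset.mem_univ a.1.1.1), pow_add, h]
      simp only [altFun, h, if_true, partialDeriv_linPoly, ← hi]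
      have : ((-1 : ℝ) ^ (a.2 : ℕ)) * (-1) ^ (a.2 : ℕ) = 1 := by
        rw [← mul_pow]; norm_num
      linear_combination (-(-2 * (-1) ^ (∑ m ∈ Finset.univ.erase a.1.1.1, (k m : ℕ)) /
        step ℓ N i)) * this
    · rw [if_neg fun h => hi h.2]
      simp only [altFun, h, if_true, partialDeriv_linPoly, hi, if_false]
  · rw [if_neg fun h' => h h'.1]
    simp only [altFun, h, if_false]
    rfl

/-- The index of the direction pair `(ι, μ)`. -/
abbrev dirPair (ι μ : Fin 3) (h : ι ≠ μ) : {p : Fin 3 × Fin 3 // p.1 ≠ p.2} := ⟨(ι, μ), h⟩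

theorem sum_dirPair {ι κ μ : Fin 3} (hι : ι ≠ μ) (hκ : κ ≠ μ) (hικ : ι ≠ κ) {M : Type}
    [AddCommMonoid M] (g : {p : Fin 3 × Fin 3 // p.1 ≠ p.2} → M)
    (hg : ∀ p, p.1.2 ≠ μ → g p = 0) : ∑ p, g p = g (dirPair ι μ hι) + g (dirPair κ μ hκ) := by
  refine Fintype.sum_eq_add _ _ (fun h => hικ (congrArg (fun p => p.1.1) h)) ?_
  rintro ⟨⟨p, q⟩, hpq⟩ ⟨h1, h2⟩
  refine hg _ fun hq => ?_
  simp only at hq hpq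
  subst hq
  have h1' : p ≠ ι := fun h => h1 (by subst h; rfl)
  have h2' : p ≠ κ := fun h => h2 (by subst h; rfl)
  omega

/-- Apart from a nonzero factor, the slope is a function of `k ι` plus a function of `k κ`. It
vanishes everywhere only if these are opposite constants, which describes all linear relations. -/
theorem derivAt_comb_altFun {ι κ μ : Fin 3} (hι : ι ≠ μ) (hκ : κ ≠ μ) (hικ : ι ≠ κ)
    (c : AltIdx N → ℝ) (k : Cell N) :
    derivAt k μ (comb (altFun ℓ N) c) =
      -2 * (-1) ^ (∑ m, (k m : ℕ)) / step ℓ N μ *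
        ((-1) ^ (k ι : ℕ) * c ⟨dirPair ι μ hι, k ι⟩ +
          (-1) ^ (k κ : ℕ) * c ⟨dirPair κ μ hκ, k κ⟩) := by
  rw [map_comb, Fintype.sum_sigma, sum_dirPair hι hκ hικ]
  · simp only [derivAt_altFun, and_true, mul_ite, mul_zero, Finset.sum_ite_eq, Finset.mem_univ,
      if_true]
    ring
  · intro p hp
    refine Finset.sum_eq_zero fun j _ => ?_
    rw [derivAt_altFun, if_neg fun h => hp h.2.symm, mul_zero]

theorem card_altIdx {ι κ μ : Fin 3} (hι : ι ≠ μ) (hκ : κ ≠ μ) (hικ : ι ≠ κ) :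
    (Finset.univ.filter fun a : AltIdx N => a.1.1.2 = μ).card =
      ∑ ι ∈ Finset.univ.erase μ, N ι := by
  rw [Finset.card_filter, Fintype.sum_sigma, sum_dirPair hι hκ hικ]
  · have : Finset.univ.erase μ = {ι, κ} := by
      revert ι κ μ; decide
    rw [this, Finset.sum_pair hικ]
    simp
  · intro p hp
    simp [hp]

/-! ### Linear relations among alternating functions. -/

theorem exists_third (ι μ : Fin 3) (h : ι ≠ μ) : ∃ κ, κ ≠ μ ∧ ι ≠ κ := by
  revert ι μ; decide

theorem exists_directions (μ : Fin 3) : ∃ ι κ : Fin 3, ι ≠ μ ∧ κ ≠ μ ∧ ι ≠ κ := by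
  revert μ; decide

theorem exists_notMem_altSelection {Af : Finset (AltIdx N)} (hA : IsAltSelection N Af)
    (μ : Fin 3) : ∃ a ∉ Af, a.1.1.2 = μ := by
  by_contra! hne
  obtain ⟨ι, κ, hι, hκ, hικ⟩ := exists_directions μ
  have h1 := hA μ
  rw [← card_altIdx hι hκ hικ] at h1
  have h2 : (Finset.univ.filter fun a : AltIdx N => a.1.1.2 = μ) ⊆
      Af.filter fun a => a.1.1.2 = μ := by
    intro a ha
    simp only [Finset.mem_filter, Finset.mem_univ, true_and] at ha ⊢
    exact ⟨by_contra fun h => hne a h ha, ha⟩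
  have := Finset.card_le_card h2
  omega

theorem mem_altSelection_of_ne {Af : Finset (AltIdx N)} (hA : IsAltSelection N Af)
    {a b : AltIdx N} (ha : a ∉ Af) (hab : b.1.1.2 = a.1.1.2) (hne : b ≠ a) : b ∈ Af := by
  by_contra hb
  obtain ⟨ι, κ, hι, hκ, hικ⟩ := exists_directions a.1.1.2
  have h1 := hA a.1.1.2
  rw [← card_altIdx hι hκ hικ] at h1
  have h2 : insert b (insert a (Af.filter fun d => d.1.1.2 = a.1.1.2)) ⊆
      Finset.univ.filter fun d : AltIdx N => d.1.1.2 = a.1.1.2 := by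
    intro d hd
    simp only [Finset.mem_insert, Finset.mem_filter, Finset.mem_univ, true_and] at hd ⊢
    rcases hd with rfl | rfl | hd
    · exact hab
    · rfl
    · exact hd.2
  have h3 := Finset.card_le_card h2
  rw [Finset.card_insert_of_notMem (by simp [hne, hb]),
    Finset.card_insert_of_notMem (by simp [ha])] at h3
  omega

variable [∀ i, NeZero (N i)]

theorem eq_zero_of_comb_altFun_eq_zero (hℓ : ∀ i, 0 < ℓ i) {c : AltIdx N → ℝ}
    (h : comb (altFun ℓ N) c = 0) {a b : AltIdx N} (hab : a.1.1.2 = b.1.1.2) (ha : c a = 0) :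
    c b = 0 := by
  obtain ⟨⟨⟨ι, μ⟩, hι⟩, j⟩ := a
  have hιμ : ι ≠ μ := hι
  obtain ⟨κ, hκ, hικ⟩ := exists_third ι μ hι
  -- The indices `x` and `y` are independent: some cell lies in both layers.
  have key : ∀ (x : Fin (N ι)) (y : Fin (N κ)), (-1) ^ (x : ℕ) * c ⟨dirPair ι μ hι, x⟩ +
      (-1) ^ (y : ℕ) * c ⟨dirPair κ μ hκ, y⟩ = 0 := by
    intro x y
    have h1 := derivAt_comb_altFun (ℓ := ℓ) hι hκ hικ c
      (Function.update (Function.update (fun _ => 0) ι x) κ y)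
    rw [h, map_zero, eq_comm, mul_eq_zero] at h1
    rw [Function.update_self, Function.update_of_ne hικ, Function.update_self] at h1
    refine h1.resolve_left ?_
    exact div_ne_zero (mul_ne_zero (by norm_num) (pow_ne_zero _ (by norm_num)))
      (step_pos hℓ N μ).ne'
  have hne : ∀ n : ℕ, ((-1 : ℝ) ^ n) ≠ 0 := fun n => pow_ne_zero _ (by norm_num)
  -- The known zero in layer `j` kills all coefficients of direction κ, and these in turn kill those
  -- of direction ι.
  have hy : ∀ y, c ⟨dirPair κ μ hκ, y⟩ = 0 := by
    intro y
    have := key j y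
    rw [show c ⟨dirPair ι μ hι, j⟩ = 0 from ha, mul_zero, zero_add] at this
    exact (mul_eq_zero.1 this).resolve_left (hne _)
  have hx : ∀ x, c ⟨dirPair ι μ hι, x⟩ = 0 := by
    intro x
    have := key x 0
    rw [hy, mul_zero, add_zero] at this
    exact (mul_eq_zero.1 this).resolve_left (hne _)
  obtain ⟨⟨⟨p, q⟩, hpq⟩, m⟩ := b
  simp only at hab hpq
  subst hab
  by_cases hp : p = ι
  · subst hp; exact hx m
  · have hp' : p = κ := by omega
    subst hp'; exact hy m

/-- Extended by zero, `c` vanishes at the function omitted for each subscript, hence on all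
functions with that subscript. -/
theorem comb_altFun_subtype_eq_zero (hℓ : ∀ i, 0 < ℓ i) {Af : Finset (AltIdx N)}
    (hA : IsAltSelection N Af) {c : Af → ℝ} (h : comb (fun a : Af => altFun ℓ N a) c = 0) :
    c = 0 := by
  let d : AltIdx N → ℝ := fun a => if ha : a ∈ Af then c ⟨a, ha⟩ else 0
  have hd : comb (altFun ℓ N) d = 0 := by
    rw [← h, comb, comb, ← Finset.sum_subset (Finset.subset_univ Af),
      ← Finset.sum_coe_sort Af fun a => d a • altFun ℓ N a]
    · refine Finset.sum_congr rfl fun a _ => ?_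
      simp [d]
    · intro a _ ha
      simp [d, ha]
  funext b
  obtain ⟨a, ha, hab⟩ := exists_notMem_altSelection hA b.1.1.1.2
  have := eq_zero_of_comb_altFun_eq_zero hℓ hd hab (dif_neg ha : d a = 0)
  simpa [d] using this

theorem span_altSelection {Af : Finset (AltIdx N)}
    (hA : IsAltSelection N Af) :
    Submodule.span ℝ (Set.range fun a : Af => altFun ℓ N a) =
      Submodule.span ℝ (Set.range (altFun ℓ N)) := by
  refine le_antisymm (Submodule.span_mono ?_) (Submodule.span_le.2 ?_)
  · rintro _ ⟨a, rfl⟩; exact ⟨a, rfl⟩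
  rintro _ ⟨a, rfl⟩
  by_cases ha : a ∈ Af
  · exact Submodule.subset_span ⟨⟨a, ha⟩, rfl⟩
  -- The relation for the subscript of `a`: after the signs are absorbed, the two directions
  -- contribute +1 and -1. Since `d a ≠ 0`, it can be solved for the omitted function.
  let d : AltIdx N → ℝ := fun b => if b.1.1.2 = a.1.1.2 then
    (if b.1.1.1 = a.1.1.1 then (-1) ^ (b.2 : ℕ) else -(-1) ^ (b.2 : ℕ)) else 0
  have hd : comb (altFun ℓ N) d = 0 := by
    refine brokenP1_ext (center ℓ N) (fun k => ?_) fun k i => ?_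
    · rw [map_zero]; exact evalAt_comb_altFun (fun a => a) d k
    · obtain ⟨⟨⟨ι, μ⟩, hι⟩, j⟩ := a
      by_cases hi : i = μ
      · subst hi
        obtain ⟨κ, hκ, hικ⟩ := exists_third ι i hι
        rw [derivAt_comb_altFun hι hκ hικ, map_zero]
        simp only [d, if_true, hικ.symm, if_false, mul_neg, ← mul_pow]
        norm_num
      · rw [map_comb, map_zero]
        refine Finset.sum_eq_zero fun b _ => ?_
        rw [derivAt_altFun]
        by_cases hb : i = b.1.1.2
        · have : b.1.1.2 ≠ μ := fun h => hi (hb.trans h)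
          simp [d, this]
        · simp [hb]
  have hda : d a ≠ 0 := by
    simp [d]
  rw [comb, ← Finset.add_sum_erase _ _ (Finset.mem_univ a)] at hd
  refine (Submodule.smul_mem_iff _ hda).1 ?_
  rw [eq_neg_of_add_eq_zero_left hd]
  refine neg_mem (Submodule.sum_mem _ fun b hb => ?_)
  by_cases hab : b.1.1.2 = a.1.1.2
  · exact Submodule.smul_mem _ _ (Submodule.subset_span
      ⟨⟨b, mem_altSelection_of_ne hA ha hab (Finset.ne_of_mem_erase hb)⟩, rfl⟩)
  · simp [d, hab]

theorem eq_zero_of_energy_of_center_eq_zero (hℓ : ∀ i, 0 < ℓ i) {v : BrokenP1 N}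
    (hv : ∀ k, evalAt k (center ℓ N k) v = 0) (h0 : energy ℓ v v = 0) : v = 0 :=
  brokenP1_ext (center ℓ N) (fun k => by rw [hv, map_zero])
    fun k i => by rw [derivAt_eq_zero_of_energy hℓ h0, map_zero]

end Alt

/-! ### Integrals of piecewise linear functions -/

section Integral

variable {ℓ : Fin 3 → ℝ} {N : Fin 3 → ℕ}

theorem measurableSet_cellSet (k : Cell N) : MeasurableSet (cellSet ℓ N k) :=
  MeasurableSet.univ_pi fun _ => measurableSet_Ioo

theorem cellSet_subset_Icc (k : Cell N) : cellSet ℓ N k ⊆ Set.Icc (lo ℓ N k) (hi ℓ N k) :=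
  fun _ hx => ⟨fun i => (hx i trivial).1.le, fun i => (hx i trivial).2.le⟩

theorem toFunc_add (u v : BrokenP1 N) (x : Fin 3 → ℝ) :
    toFunc ℓ (u + v) x = toFunc ℓ u x + toFunc ℓ v x := by
  simp only [toFunc, ← Finset.sum_add_distrib]
  refine Finset.sum_congr rfl fun k _ => ?_
  by_cases h : x ∈ cellSet ℓ N k <;> simp [h]

theorem toFunc_smul (r : ℝ) (v : BrokenP1 N) (x : Fin 3 → ℝ) :
    toFunc ℓ (r • v) x = r * toFunc ℓ v x := by
  simp only [toFunc, Finset.mul_sum]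
  refine Finset.sum_congr rfl fun k _ => ?_
  by_cases h : x ∈ cellSet ℓ N k <;> simp [h]

theorem mul_toFunc (g : (Fin 3 → ℝ) → ℝ) (v : BrokenP1 N) (x : Fin 3 → ℝ) :
    g x * toFunc ℓ v x = ∑ k, (cellSet ℓ N k).indicator (fun y => g y * v k y) x := by
  simp only [toFunc, Finset.mul_sum]
  refine Finset.sum_congr rfl fun k _ => ?_
  by_cases h : x ∈ cellSet ℓ N k <;> simp [h]

theorem sq_apply_le_of_center_eq_zero {h : ℝ} (hh : ∀ i, step ℓ N i ≤ h)
    {v : BrokenP1 N} {k : Cell N} (hv : evalAt k (center ℓ N k) v = 0) {x : Fin 3 → ℝ}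
    (hx : x ∈ cellSet ℓ N k) :
    v k x * v k x ≤ h ^ 2 * ∑ i, derivAt k i v * derivAt k i v := by
  have habs : ∀ i, (x i - center ℓ N k i) ^ 2 ≤ h ^ 2 / 4 := by
    intro i
    have h1 := (hx i trivial).1
    have h2 := (hx i trivial).2
    have h3 := hh i
    simp only [lo, hi] at h1 h2
    have : |x i - center ℓ N k i| ≤ h / 2 := by
      rw [abs_le, center]
      constructor <;> linarith
    calc (x i - center ℓ N k i) ^ 2 = |x i - center ℓ N k i| ^ 2 := (sq_abs _).symm
      _ ≤ (h / 2) ^ 2 := by gcongr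
      _ = h ^ 2 / 4 := by ring
  have hterm : ∀ i, (derivAt k i v * (x i - center ℓ N k i)) ^ 2 ≤
      h ^ 2 / 4 * (derivAt k i v * derivAt k i v) := by
    intro i
    rw [mul_pow, mul_comm, ← pow_two]
    exact mul_le_mul_of_nonneg_right (habs i) (sq_nonneg _)
  have hval : v k x = ∑ i, derivAt k i v * (x i - center ℓ N k i) := by
    rw [apply_eq_taylor (v k) (center ℓ N k) x, show v k (center ℓ N k) = 0 from hv, zero_add]
    rfl
  rw [hval, ← pow_two]
  -- Cauchy–Schwarz with three terms costs 3, and 3 · h²/4 ≤ h².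
  refine (sq_sum_le_card_mul_sum_sq).trans ?_
  have hsum := Finset.sum_le_sum fun i (_ : i ∈ Finset.univ) => hterm i
  rw [← Finset.mul_sum] at hsum
  have hn : 0 ≤ h ^ 2 * ∑ i, derivAt k i v * derivAt k i v :=
    mul_nonneg (sq_nonneg _) (Finset.sum_nonneg fun _ _ => mul_self_nonneg _)
  simp only [Finset.card_univ, Fintype.card_fin, Nat.cast_ofNat]
  linarith

variable [∀ i, NeZero (N i)]

theorem cast_ne_zero (i : Fin 3) : (N i : ℝ) ≠ 0 := Nat.cast_ne_zero.2 (NeZero.ne _)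

theorem cellSet_subset_Omega (hℓ : ∀ i, 0 < ℓ i) (k : Cell N) : cellSet ℓ N k ⊆ Omega ℓ := by
  intro x hx i _
  have hs := step_pos hℓ N i
  have hx1 := (hx i trivial).1
  have hx2 := (hx i trivial).2
  simp only [lo, hi] at hx1 hx2
  refine ⟨lt_of_le_of_lt (by positivity) hx1, lt_of_lt_of_le hx2 ?_⟩
  have h1 : ((k i : ℕ) : ℝ) + 1 ≤ N i := by exact_mod_cast (k i).2
  calc _ ≤ (N i : ℝ) * step ℓ N i := mul_le_mul_of_nonneg_right h1 hs.le
    _ = ℓ i := by rw [step]; field_simp [cast_ne_zero (N := N) i]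

theorem disjoint_cellSet (hℓ : ∀ i, 0 < ℓ i) {k k' : Cell N} (h : k ≠ k') :
    Disjoint (cellSet ℓ N k) (cellSet ℓ N k') := by
  refine Set.disjoint_left.2 fun x hx hx' => h (funext fun i => Fin.ext ?_)
  have hs := step_pos hℓ N i
  have h1 := (hx i trivial).1.trans (hx' i trivial).2
  have h2 := (hx' i trivial).1.trans (hx i trivial).2
  simp only [lo, hi] at h1 h2
  have h3 := lt_of_mul_lt_mul_right h1 hs.le
  have h4 := lt_of_mul_lt_mul_right h2 hs.le
  norm_cast at h3 h4
  omega

/-- The null skeleton is never described: the disjoint cells lie in the box and their volumes add up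
to its volume. -/
theorem iUnion_cellSet_ae_eq (hℓ : ∀ i, 0 < ℓ i) :
    (⋃ k, cellSet ℓ N k) =ᵐ[volume] Omega ℓ := by
  have hsub : (⋃ k, cellSet ℓ N k) ⊆ Omega ℓ := Set.iUnion_subset (cellSet_subset_Omega hℓ)
  have hfin : volume (Omega ℓ) ≠ ⊤ := by
    rw [Omega, Real.volume_pi_Ioo]
    exact ENNReal.prod_ne_top fun _ _ => ENNReal.ofReal_ne_top
  have hfin' : ∀ k : Cell N, volume (cellSet ℓ N k) ≠ ⊤ := fun k =>
    ne_top_of_le_ne_top hfin (measure_mono (cellSet_subset_Omega hℓ k))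
  refine ae_eq_of_subset_of_measure_ge hsub (le_of_eq ?_)
    (MeasurableSet.iUnion measurableSet_cellSet).nullMeasurableSet hfin
  rw [← ENNReal.toReal_eq_toReal_iff' hfin (ne_top_of_le_ne_top hfin (measure_mono hsub)),
    measure_iUnion (fun _ _ h => disjoint_cellSet hℓ h) measurableSet_cellSet, tsum_fintype,
    ENNReal.toReal_sum fun k _ => hfin' k]
  have hvol : ∀ k : Cell N, (volume (cellSet ℓ N k)).toReal = cellVol ℓ N :=
    volume_real_cellSet hℓ
  simp only [hvol, Finset.sum_const, nsmul_eq_mul, Finset.card_univ]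
  rw [Omega, Real.volume_pi_Ioo_toReal fun i => (hℓ i).le, Fintype.card_pi]
  simp only [sub_zero, Fintype.card_fin, cellVol, Nat.cast_prod, ← Finset.prod_mul_distrib]
  refine Finset.prod_congr rfl fun i _ => ?_
  rw [step]; field_simp [cast_ne_zero (N := N) i]

theorem integrableOn_cell {g : (Fin 3 → ℝ) → ℝ} (hℓ : ∀ i, 0 < ℓ i)
    (hg : IntegrableOn g (Omega ℓ)) (v : BrokenP1 N) (k : Cell N) :
    IntegrableOn (fun x => g x * v k x) (cellSet ℓ N k) :=
  (hg.mono_set (cellSet_subset_Omega hℓ k)).mul_continuousOn_of_subset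
    (v k).continuous_of_finiteDimensional.continuousOn (measurableSet_cellSet k) isCompact_Icc
    (cellSet_subset_Icc k)

theorem integrableOn_indicator {g : (Fin 3 → ℝ) → ℝ} (hℓ : ∀ i, 0 < ℓ i)
    (hg : IntegrableOn g (Omega ℓ)) (v : BrokenP1 N) (k : Cell N) :
    IntegrableOn ((cellSet ℓ N k).indicator fun y => g y * v k y) (Omega ℓ) :=
  ((integrable_indicator_iff (measurableSet_cellSet k)).2
    (integrableOn_cell hℓ hg v k)).integrableOn

theorem integrableOn_mul_toFunc {g : (Fin 3 → ℝ) → ℝ} (hℓ : ∀ i, 0 < ℓ i)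
    (hg : IntegrableOn g (Omega ℓ)) (v : BrokenP1 N) :
    IntegrableOn (fun x => g x * toFunc ℓ v x) (Omega ℓ) := by
  simp only [mul_toFunc]
  exact integrable_finsetSum _ fun k _ => integrableOn_indicator hℓ hg v k

theorem integral_mul_toFunc {g : (Fin 3 → ℝ) → ℝ} (hℓ : ∀ i, 0 < ℓ i)
    (hg : IntegrableOn g (Omega ℓ)) (v : BrokenP1 N) :
    ∫ x in Omega ℓ, g x * toFunc ℓ v x = ∑ k, ∫ x in cellSet ℓ N k, g x * v k x := by
  simp only [mul_toFunc]
  rw [integral_finsetSum _ fun k _ => integrableOn_indicator hℓ hg v k]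
  refine Finset.sum_congr rfl fun k _ => ?_
  rw [setIntegral_indicator (measurableSet_cellSet k),
    Set.inter_eq_right.2 (cellSet_subset_Omega hℓ k)]

theorem integral_Omega (hℓ : ∀ i, 0 < ℓ i) {g : (Fin 3 → ℝ) → ℝ}
    (hg : IntegrableOn g (Omega ℓ)) :
    ∫ x in Omega ℓ, g x = ∑ k : Cell N, ∫ x in cellSet ℓ N k, g x := by
  rw [← setIntegral_congr_set (iUnion_cellSet_ae_eq (N := N) hℓ),
    integral_iUnion_fintype measurableSet_cellSet (fun _ _ h => disjoint_cellSet hℓ h)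
      fun k => hg.mono_set (cellSet_subset_Omega hℓ k)]

/-- On the cell boundaries `toFunc` of the constant is 0, so this needs the cells to exhaust the box
up to a null set. -/
theorem integral_mul_one (hℓ : ∀ i, 0 < ℓ i) {g : (Fin 3 → ℝ) → ℝ}
    (hg : IntegrableOn g (Omega ℓ)) :
    ∫ x in Omega ℓ, g x * toFunc ℓ (one N) x = ∫ x in Omega ℓ, g x := by
  rw [integral_mul_toFunc hℓ hg, integral_Omega (N := N) hℓ hg]
  simp [one]

/-- The linear functional `v ↦ ∫_Ω f v`. -/
def loadForm (hℓ : ∀ i, 0 < ℓ i) {f : (Fin 3 → ℝ) → ℝ} (hf : IntegrableOn f (Omega ℓ)) :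
    BrokenP1 N →ₗ[ℝ] ℝ where
  toFun v := ∫ x in Omega ℓ, f x * toFunc ℓ v x
  map_add' u v := by
    simp only [toFunc_add, mul_add]
    exact integral_add (integrableOn_mul_toFunc hℓ hf u) (integrableOn_mul_toFunc hℓ hf v)
  map_smul' r v := by
    simp only [toFunc_smul, mul_left_comm _ r, integral_const_mul, RingHom.id_apply, smul_eq_mul]

theorem dotProduct_load (hℓ : ∀ i, 0 < ℓ i) {f : (Fin 3 → ℝ) → ℝ}
    (hf : IntegrableOn f (Omega ℓ)) {I : Type} [Fintype I] (b : I → BrokenP1 N) (c : I → ℝ) :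
    c ⬝ᵥ load ℓ f b = loadForm hℓ hf (comb b c) := by
  rw [map_comb]; rfl

theorem loadForm_one (hℓ : ∀ i, 0 < ℓ i) {f : (Fin 3 → ℝ) → ℝ}
    (hf : IntegrableOn f (Omega ℓ)) (h0 : ∫ x in Omega ℓ, f x = 0) :
    loadForm hℓ hf (one N) = 0 :=
  (integral_mul_one hℓ hf).trans h0

theorem toFunc_of_mem (hℓ : ∀ i, 0 < ℓ i) (v : BrokenP1 N) {k : Cell N} {x : Fin 3 → ℝ}
    (hx : x ∈ cellSet ℓ N k) : toFunc ℓ v x = v k x := by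
  rw [toFunc, Finset.sum_eq_single k]
  · rw [Set.indicator_of_mem hx]
  · intro k' _ hk
    exact Set.indicator_of_notMem (Set.disjoint_left.1 (disjoint_cellSet hℓ hk.symm) hx) _
  · exact fun h => absurd (Finset.mem_univ k) h

theorem integrableOn_const_one : IntegrableOn (fun _ : Fin 3 → ℝ => (1 : ℝ)) (Omega ℓ) := by
  refine integrableOn_const ?_
  rw [Omega, Real.volume_pi_Ioo]
  exact ENNReal.prod_ne_top fun _ _ => ENNReal.ofReal_ne_top

theorem integrableOn_toFunc (hℓ : ∀ i, 0 < ℓ i) (v : BrokenP1 N) :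
    IntegrableOn (toFunc ℓ v) (Omega ℓ) := by
  simpa using integrableOn_mul_toFunc hℓ integrableOn_const_one v

/-- Piecewise linear functions with vanishing values at the barycenters of the cells satisfy a
Poincaré inequality with constant `h`. -/
theorem integral_sq_le_of_center_eq_zero {h : ℝ} (hℓ : ∀ i, 0 < ℓ i)
    (hh : ∀ i, step ℓ N i ≤ h) {v : BrokenP1 N} (hv : ∀ k, evalAt k (center ℓ N k) v = 0) :
    ∫ x in Omega ℓ, toFunc ℓ v x ^ 2 ≤ h ^ 2 * energy ℓ v v := by
  simp only [pow_two (toFunc ℓ v _)]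
  rw [integral_mul_toFunc hℓ (integrableOn_toFunc hℓ v), energy_eq hℓ, Finset.mul_sum,
    Finset.mul_sum]
  refine Finset.sum_le_sum fun k _ => ?_
  calc _ ≤ ∫ _x in cellSet ℓ N k, h ^ 2 * ∑ i, derivAt k i v * derivAt k i v := by
        refine setIntegral_mono_on (integrableOn_cell hℓ (integrableOn_toFunc hℓ v) v k) ?_
          (measurableSet_cellSet k) fun x hx => ?_
        · exact integrableOn_const (ne_top_of_le_ne_top
            (isCompact_Icc (a := lo ℓ N k) (b := hi ℓ N k)).measure_lt_top.ne
            (measure_mono (cellSet_subset_Icc k)))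
        · rw [toFunc_of_mem hℓ v hx]
          exact sq_apply_le_of_center_eq_zero hh (hv k) hx
    _ = _ := by
        rw [setIntegral_const, volume_real_cellSet hℓ, smul_eq_mul]
        ring

/-- Young's inequality for the load, with weights chosen so that the Poincaré inequality turns the
`v` term into half the energy, which is absorbed on the left. -/
theorem energy_le_of_center_eq_zero {h : ℝ} (hh0 : 0 < h) (hℓ : ∀ i, 0 < ℓ i)
    (hh : ∀ i, step ℓ N i ≤ h) {f : (Fin 3 → ℝ) → ℝ}
    (hf2 : MemLp f 2 (volume.restrict (Omega ℓ))) (hf : IntegrableOn f (Omega ℓ))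
    {v : BrokenP1 N} (hv : ∀ k, evalAt k (center ℓ N k) v = 0)
    (hvf : energy ℓ v v = loadForm hℓ hf v) :
    energy ℓ v v ≤ h ^ 2 * ∫ x in Omega ℓ, f x ^ 2 := by
  have hW := integral_sq_le_of_center_eq_zero hℓ hh hv
  have hint : IntegrableOn (fun x => toFunc ℓ v x ^ 2) (Omega ℓ) := by
    simp only [pow_two]
    exact integrableOn_mul_toFunc hℓ (integrableOn_toFunc hℓ v) v
  have hint2 : IntegrableOn (fun x => f x ^ 2) (Omega ℓ) := hf2.integrable_sq
  have hle : loadForm hℓ hf v ≤ ∫ x in Omega ℓ,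
      (h ^ 2 / 2 * f x ^ 2 + (h ^ 2)⁻¹ / 2 * toFunc ℓ v x ^ 2) := by
    refine integral_mono (integrableOn_mul_toFunc hℓ hf v)
      ((hint2.const_mul _).add (hint.const_mul _)) fun x => ?_
    have h1 : 0 ≤ (h * f x - h⁻¹ * toFunc ℓ v x) ^ 2 := sq_nonneg _
    have h2 : (h * f x - h⁻¹ * toFunc ℓ v x) ^ 2 =
        h ^ 2 * f x ^ 2 + (h ^ 2)⁻¹ * toFunc ℓ v x ^ 2 - 2 * (f x * toFunc ℓ v x) := by
      field_simp
      ring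
    simp only
    linarith
  rw [integral_add (hint2.const_mul _) (hint.const_mul _), integral_const_mul,
    integral_const_mul, ← hvf] at hle
  have h3 : (h ^ 2)⁻¹ / 2 * ∫ x in Omega ℓ, toFunc ℓ v x ^ 2 ≤ energy ℓ v v / 2 := by
    calc _ ≤ (h ^ 2)⁻¹ / 2 * (h ^ 2 * energy ℓ v v) :=
          mul_le_mul_of_nonneg_left hW (by positivity)
      _ = _ := by field_simp
  linarith

end Integral

/-! ### Galerkin solutions -/

section Galerkin

variable {ℓ : Fin 3 → ℝ} {N : Fin 3 → ℕ}

theorem solves23_iff {I J : Type} [Fintype I] [Fintype J] {f : (Fin 3 → ℝ) → ℝ}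
    {φ : I → BrokenP1 N} {ψ : J → BrokenP1 N} {u : I ⊕ J → ℝ} :
    Solves23 ℓ f φ ψ u ↔ ((stiffness ℓ φ).mulVec (u ∘ Sum.inl) = load ℓ f φ ∧
      ∑ j, (u ∘ Sum.inl) j = 0) ∧ (stiffness ℓ ψ).mulVec (u ∘ Sum.inr) = load ℓ f ψ := by
  simp only [Solves23, Matrix.fromBlocks_mulVec, Matrix.zero_mulVec, add_zero, zero_add,
    Sum.elim_eq_iff, Function.comp_apply]
  tauto

variable [∀ i, NeZero (N i)]

/-- Replacing one row of a consistent singular symmetric system by a normalization. -/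
theorem updateRow_mulVec_eq_iff {I : Type} [Fintype I] [DecidableEq I] {A : Matrix I I ℝ}
    (hA : A.IsSymm) {b w : I → ℝ} {last : I} (hw : A.mulVec w = 0) (hwl : w last ≠ 0)
    (hwb : w ⬝ᵥ b = 0) (c : I → ℝ) :
    (A.updateRow last fun _ => 1).mulVec c = Function.update b last 0 ↔
      A.mulVec c = b ∧ ∑ j, c j = 0 := by
  have hlast : (A.updateRow last fun _ => 1).mulVec c last = ∑ j, c j := by
    simp [Matrix.mulVec, dotProduct]
  have hne : ∀ j, j ≠ last → (A.updateRow last fun _ => 1).mulVec c j = A.mulVec c j := by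
    intro j hj
    simp [Matrix.mulVec, Matrix.updateRow_ne hj]
  constructor
  · intro h
    have hoff : ∀ j, j ≠ last → A.mulVec c j = b j := by
      intro j hj
      rw [← hne j hj, h, Function.update_of_ne hj]
    refine ⟨?_, by rw [← hlast, h, Function.update_self]⟩
    -- Both terms are orthogonal to `w`. Off `last` the residual is already zero, so the sum reduces
    -- to one entry, where `w last ≠ 0`.
    have hdot : w ⬝ᵥ (A.mulVec c - b) = 0 := by
      rw [dotProduct_sub, dotProduct_mulVec_comm hA, hw, zero_dotProduct, hwb, sub_zero]
    rw [dotProduct, Finset.sum_eq_single last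
      (fun j _ hj => by rw [Pi.sub_apply, hoff j hj, sub_self, mul_zero])
      fun h => absurd (Finset.mem_univ _) h, mul_eq_zero, or_iff_right hwl] at hdot
    funext j
    by_cases hj : j = last
    · subst hj; exact sub_eq_zero.1 hdot
    · exact hoff j hj
  · rintro ⟨h1, h2⟩
    funext j
    by_cases hj : j = last
    · subst hj; rw [hlast, h2, Function.update_self]
    · rw [hne j hj, h1, Function.update_of_ne hj]

/-- `v ∈ S` satisfies `a_h(v, w) = L w` for all `w ∈ S`. -/
def IsGalerkin (ℓ : Fin 3 → ℝ) (L : BrokenP1 N →ₗ[ℝ] ℝ) (S : Submodule ℝ (BrokenP1 N))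
    (v : BrokenP1 N) : Prop :=
  v ∈ S ∧ ∀ w ∈ S, energy ℓ v w = L w

/-- Passes from coefficients to functions: the outcome mentions the family only through its span, so
linearly dependent families are allowed. -/
theorem isGalerkin_comb (hℓ : ∀ i, 0 < ℓ i) {f : (Fin 3 → ℝ) → ℝ}
    (hf : IntegrableOn f (Omega ℓ)) {I : Type} [Fintype I] {b : I → BrokenP1 N} {c : I → ℝ}
    (h : (stiffness ℓ b).mulVec c = load ℓ f b) :
    IsGalerkin ℓ (loadForm hℓ hf) (Submodule.span ℝ (Set.range b)) (comb b c) := by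
  refine ⟨comb_mem_span b c, fun w hw => ?_⟩
  rw [energy_comm, ← energyLeft_apply hℓ]
  refine LinearMap.eqOn_span (f := energyLeft ℓ N (comb b c)) ?_ hw
  rintro _ ⟨j, rfl⟩
  rw [energyLeft_apply hℓ, energy_comm, ← stiffness_mulVec hℓ, h]
  rfl

theorem IsGalerkin.energy_sub_eq_zero (hℓ : ∀ i, 0 < ℓ i) {L : BrokenP1 N →ₗ[ℝ] ℝ}
    {S : Submodule ℝ (BrokenP1 N)} {u v : BrokenP1 N} (hu : IsGalerkin ℓ L S u)
    (hv : IsGalerkin ℓ L S v) : energy ℓ (u - v) (u - v) = 0 := by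
  have hmem := sub_mem hu.1 hv.1
  have h := (energyLeft ℓ N (u - v)).map_sub u v
  rw [energyLeft_apply hℓ, energyLeft_apply hℓ, energyLeft_apply hℓ, hu.2 _ hmem,
    hv.2 _ hmem, sub_self] at h
  exact h

theorem energy_comb_self_eq_zero (hℓ : ∀ i, 0 < ℓ i) {I : Type} [Fintype I]
    {b : I → BrokenP1 N} {c : I → ℝ} (h : (stiffness ℓ b).mulVec c = 0) :
    energy ℓ (comb b c) (comb b c) = 0 :=
  energy_comb_eq_zero hℓ b _ (fun j => by rw [← stiffness_mulVec hℓ, h]; rfl) _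
    (comb_mem_span b c)

theorem stiffness_mulVec_eq_zero (hℓ : ∀ i, 0 < ℓ i) {I : Type} [Fintype I]
    {b : I → BrokenP1 N} {c : I → ℝ} {t : ℝ} (h : comb b c = t • one N) :
    (stiffness ℓ b).mulVec c = 0 := by
  funext j
  rw [stiffness_mulVec hℓ, h, ← energyLeft_apply hℓ, map_smul, energyLeft_apply hℓ,
    energy_one hℓ, smul_zero]
  rfl

theorem IsGalerkin.eq_of_cellSum_eq_zero (hℓ : ∀ i, 0 < ℓ i) (hN : ∀ i, Even (N i))
    {L : BrokenP1 N →ₗ[ℝ] ℝ} {u v : BrokenP1 N}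
    (hu : IsGalerkin ℓ L (Submodule.span ℝ (Set.range (nodeFun ℓ N))) u)
    (hv : IsGalerkin ℓ L (Submodule.span ℝ (Set.range (nodeFun ℓ N))) v)
    (hu0 : cellSum ℓ N u = 0) (hv0 : cellSum ℓ N v = 0) : u = v := by
  have hV : Submodule.span ℝ (Set.range (nodeFun ℓ N)) ≤ Vper ℓ N := by
    refine Submodule.span_le.2 ?_
    rintro _ ⟨z, rfl⟩
    exact nodeFun_mem_Vper hℓ hN z
  refine sub_eq_zero.1 (eq_zero_of_energy_of_cellSum hℓ (hV (sub_mem hu.1 hv.1))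
    (hu.energy_sub_eq_zero hℓ hv) ?_)
  rw [map_sub, hu0, hv0, sub_zero]

/-- Kernel vectors represent constants, which the load annihilates because `f` has mean zero. -/
theorem exists_node_solution (hℓ : ∀ i, 0 < ℓ i) (hN : ∀ i, Even (N i)) {f : (Fin 3 → ℝ) → ℝ}
    (hf : IntegrableOn f (Omega ℓ)) (h0 : ∫ x in Omega ℓ, f x = 0) :
    ∃ u, (stiffness ℓ (nodeFun ℓ N)).mulVec u = load ℓ f (nodeFun ℓ N) := by
  refine exists_mulVec_eq_of_isSymm (stiffness_isSymm _) _ fun c hc => ?_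
  obtain ⟨t, ht⟩ := eq_smul_one_of_energy_eq_zero hℓ
    (comb_nodeFun_mem_Vper hℓ hN (fun z => z) c) (energy_comb_self_eq_zero hℓ hc)
  rw [dotProduct_load hℓ hf, ht, map_smul, loadForm_one hℓ hf h0, smul_zero]

/-- The full family is dependent, but kernel vectors represent the zero function, so the load is
compatible without any condition on the mean of `f`. -/
theorem exists_alt_solution (hℓ : ∀ i, 0 < ℓ i) {f : (Fin 3 → ℝ) → ℝ}
    (hf : IntegrableOn f (Omega ℓ)) :
    ∃ u, (stiffness ℓ (altFun ℓ N)).mulVec u = load ℓ f (altFun ℓ N) := by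
  refine exists_mulVec_eq_of_isSymm (stiffness_isSymm _) _ fun c hc => ?_
  rw [dotProduct_load hℓ hf, eq_zero_of_energy_of_center_eq_zero hℓ (evalAt_comb_altFun (fun a => a) c)
    (energy_comb_self_eq_zero hℓ hc), map_zero]

theorem alt_coeff_eq_zero (hℓ : ∀ i, 0 < ℓ i) {Af : Finset (AltIdx N)}
    (hA : IsAltSelection N Af) {c : Af → ℝ}
    (hc : (stiffness ℓ fun a : Af => altFun ℓ N a).mulVec c = 0) : c = 0 :=
  comb_altFun_subtype_eq_zero hℓ hA (eq_zero_of_energy_of_center_eq_zero hℓ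
    (evalAt_comb_altFun (fun a : Af => (a : AltIdx N)) c) (energy_comb_self_eq_zero hℓ hc))

theorem node_coeff_eq_zero (hℓ : ∀ i, 0 < ℓ i) (hN : ∀ i, Even (N i)) {Bf : Finset (Node N)}
    (hB : IsNodeBasis ℓ N Bf) {c : Bf → ℝ}
    (hc : (stiffness ℓ fun z : Bf => nodeFun ℓ N z).mulVec c = 0) (hs : ∑ j, c j = 0) :
    c = 0 := by
  have h := eq_zero_of_energy_of_cellSum hℓ (comb_nodeFun_mem_Vper hℓ hN (fun z : Bf => (z : Node N)) c)
    (energy_comb_self_eq_zero hℓ hc) (by rw [cellSum_comb hN, hs, mul_zero])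
  exact funext (Fintype.linearIndependent_iff.1 hB.1 c h)

/-- If all coefficients of 1 vanished, 1 would be 0. -/
theorem exists_isAdmissibleLast (hℓ : ∀ i, 0 < ℓ i) (hN : ∀ i, Even (N i))
    {Bf : Finset (Node N)} (hB : IsNodeBasis ℓ N Bf) :
    ∃ last : Bf, IsAdmissibleLast ℓ N Bf last := by
  have hmem := one_mem_span (ℓ := ℓ) hN
  rw [← span_nodeBasis hℓ hN hB] at hmem
  obtain ⟨w, hw⟩ := (Submodule.mem_span_range_iff_exists_fun ℝ).1 hmem
  by_contra! hne
  have hw0 : w = 0 := by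
    funext z
    by_contra hz
    exact hne z ⟨w, hw, hz⟩
  have h1 : one N = 0 := by rw [← hw, hw0]; simp
  exact cellSum_one_ne_zero (ℓ := ℓ) (N := N) (by rw [h1, map_zero])

theorem solves1_iff_solves23 (hℓ : ∀ i, 0 < ℓ i) {f : (Fin 3 → ℝ) → ℝ}
    (hf : IntegrableOn f (Omega ℓ)) (h0 : ∫ x in Omega ℓ, f x = 0) {Bf : Finset (Node N)}
    {last : Bf} (hlast : IsAdmissibleLast ℓ N Bf last) {J : Type} [Fintype J]
    (ψ : J → BrokenP1 N) (u : Bf ⊕ J → ℝ) :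
    Solves1 ℓ f (fun z : Bf => nodeFun ℓ N z) ψ last u ↔
      Solves23 ℓ f (fun z : Bf => nodeFun ℓ N z) ψ u := by
  obtain ⟨w, hw, hwl⟩ := hlast
  have hw' : comb (fun z : Bf => nodeFun ℓ N z) w = (1 : ℝ) • one N := by rw [one_smul]; exact hw
  rw [solves23_iff, ← updateRow_mulVec_eq_iff (stiffness_isSymm _)
    (stiffness_mulVec_eq_zero hℓ hw') hwl]
  · simp only [Solves1, Matrix.fromBlocks_mulVec, Matrix.zero_mulVec, add_zero, zero_add,
      Sum.elim_eq_iff]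
  · rw [dotProduct_load hℓ hf, hw', map_smul, loadForm_one hℓ hf h0, smul_zero]

theorem existsUnique_solves1 (hℓ : ∀ i, 0 < ℓ i) (hN : ∀ i, Even (N i)) (f : (Fin 3 → ℝ) → ℝ)
    {Bf : Finset (Node N)} (hB : IsNodeBasis ℓ N Bf) {Af : Finset (AltIdx N)}
    (hA : IsAltSelection N Af) {last : Bf} (hlast : IsAdmissibleLast ℓ N Bf last) :
    ∃! u, Solves1 ℓ f (fun z : Bf => nodeFun ℓ N z) (fun a : Af => altFun ℓ N a) last u := by
  obtain ⟨w, hw, hwl⟩ := hlast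
  have hw' : comb (fun z : Bf => nodeFun ℓ N z) w = (1 : ℝ) • one N := by rw [one_smul]; exact hw
  refine existsUnique_mulVec_eq (fun c hc => ?_) _
  rw [Matrix.fromBlocks_mulVec, ← Sum.elim_zero_zero, Sum.elim_eq_iff] at hc
  simp only [Matrix.zero_mulVec, add_zero, zero_add] at hc
  obtain ⟨hc1, hc2⟩ := hc
  -- Puts the homogeneous system into the form of the row replacement lemma with `b = 0`.
  have hupd : Function.update (0 : Bf → ℝ) last 0 = 0 := Function.update_eq_self last 0
  rw [← hupd, updateRow_mulVec_eq_iff (stiffness_isSymm _)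
    (stiffness_mulVec_eq_zero hℓ hw') hwl (dotProduct_zero w)] at hc1
  have h1 := node_coeff_eq_zero hℓ hN hB hc1.1 hc1.2
  have h2 := alt_coeff_eq_zero hℓ hA hc2
  funext j
  cases j with
  | inl j => exact congrFun h1 j
  | inr j => exact congrFun h2 j

theorem exists_solves23 (hℓ : ∀ i, 0 < ℓ i) (hN : ∀ i, Even (N i)) {f : (Fin 3 → ℝ) → ℝ}
    (hf : IntegrableOn f (Omega ℓ)) (h0 : ∫ x in Omega ℓ, f x = 0) :
    ∃ u, Solves23 ℓ f (nodeFun ℓ N) (altFun ℓ N) u := by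
  obtain ⟨u, hu⟩ := exists_node_solution hℓ hN hf h0
  obtain ⟨v, hv⟩ := exists_alt_solution (N := N) hℓ hf
  have hcard : (Fintype.card (Node N) : ℝ) ≠ 0 := Nat.cast_ne_zero.2 Fintype.card_ne_zero
  -- Subtracting the mean of the coefficients moves along the all-ones kernel vector.
  refine ⟨Sum.elim (u - ((∑ z, u z) / Fintype.card (Node N)) • fun _ => (1 : ℝ)) v,
    solves23_iff.2 ⟨⟨?_, ?_⟩, hv⟩⟩
  · rw [Sum.elim_comp_inl, Matrix.mulVec_sub, Matrix.mulVec_smul, hu,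
      stiffness_mulVec_eq_zero hℓ (comb_nodeFun_one hN), smul_zero, sub_zero]
  · rw [Sum.elim_comp_inl]
    simp only [Pi.sub_apply, Pi.smul_apply, smul_eq_mul, mul_one, Finset.sum_sub_distrib,
      Finset.sum_const, Finset.card_univ, nsmul_eq_mul]
    field_simp
    ring

theorem sum_eq_zero_of_solves4 (hℓ : ∀ i, 0 < ℓ i) (hN : ∀ i, Even (N i))
    {f : (Fin 3 → ℝ) → ℝ} (hf : IntegrableOn f (Omega ℓ)) (h0 : ∫ x in Omega ℓ, f x = 0)
    {u₀ u : Node N → ℝ} (hu₀ : ∑ z, u₀ z = 0) (hu : Solves4 ℓ f (nodeFun ℓ N) u₀ u) :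
    ∑ z, u z = 0 := by
  have hker := stiffness_mulVec_eq_zero hℓ (comb_nodeFun_one (ℓ := ℓ) hN)
  have h := dotProduct_eq_zero_of_mem_krylov (stiffness_isSymm _) hker ?_ hu.2
  · simpa [dotProduct, hu₀] using h
  · rw [dotProduct_sub, dotProduct_load hℓ hf, comb_nodeFun_one hN, map_smul,
      loadForm_one hℓ hf h0, dotProduct_mulVec_comm (stiffness_isSymm _), hker, smul_zero,
      zero_dotProduct, sub_zero]

end Galerkin

end P1NC

end

/-! ### Comparison of the four solutions. -/

theorem theorem6p14 :
    ∃ C : ℝ, 0 < C ∧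
      ∀ (ℓ : Fin 3 → ℝ) (_ : ∀ i, 0 < ℓ i) (N : Fin 3 → ℕ) [∀ i, NeZero (N i)]
        (_ : ∀ i, Even (N i)) (h : ℝ) (_ : ∀ i, P1NC.step ℓ N i ≤ h)
        (f : (Fin 3 → ℝ) → ℝ) (_ : MemLp f 2 (volume.restrict (P1NC.Omega ℓ)))
        (_ : ∫ x in P1NC.Omega ℓ, f x = 0)
        (Bf : Finset (P1NC.Node N)) (_ : P1NC.IsNodeBasis ℓ N Bf)
        (Af : Finset (P1NC.AltIdx N)) (_ : P1NC.IsAltSelection N Af),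
        let φ : P1NC.Node N → P1NC.BrokenP1 N := P1NC.nodeFun ℓ N
        let ψ : P1NC.AltIdx N → P1NC.BrokenP1 N := P1NC.altFun ℓ N
        let φf : Bf → P1NC.BrokenP1 N := fun z => φ z
        let ψf : Af → P1NC.BrokenP1 N := fun a => ψ a
        (∃ last : Bf, P1NC.IsAdmissibleLast ℓ N Bf last) ∧
        (∀ last : Bf, P1NC.IsAdmissibleLast ℓ N Bf last →
          ∃! u : Bf ⊕ Af → ℝ, P1NC.Solves1 ℓ f φf ψf last u) ∧
        (∃! u : Bf ⊕ Af → ℝ, P1NC.Solves23 ℓ f φf ψf u) ∧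
        (∃ u : P1NC.Node N ⊕ P1NC.AltIdx N → ℝ, P1NC.Solves23 ℓ f φ ψ u) ∧
        (∀ u₀ : P1NC.Node N → ℝ, ∑ z, u₀ z = 0 →
          ∃! u : P1NC.Node N → ℝ, P1NC.Solves4 ℓ f φ u₀ u) ∧
        ∀ (last : Bf) (_ : P1NC.IsAdmissibleLast ℓ N Bf last)
          (u₁ : Bf ⊕ Af → ℝ) (_ : P1NC.Solves1 ℓ f φf ψf last u₁)
          (u₂ : Bf ⊕ Af → ℝ) (_ : P1NC.Solves23 ℓ f φf ψf u₂)
          (u₃ : P1NC.Node N ⊕ P1NC.AltIdx N → ℝ) (_ : P1NC.Solves23 ℓ f φ ψ u₃)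
          (u₀ : P1NC.Node N → ℝ) (_ : ∑ z, u₀ z = 0)
          (u₄ : P1NC.Node N → ℝ) (_ : P1NC.Solves4 ℓ f φ u₀ u₄),
          P1NC.comb (P1NC.joined φf ψf) u₁ = P1NC.comb (P1NC.joined φf ψf) u₂ ∧
          P1NC.comb (P1NC.joined φf ψf) u₂ = P1NC.comb (P1NC.joined φ ψ) u₃ ∧
          P1NC.l2Norm ℓ (P1NC.toFunc ℓ
            (P1NC.comb (P1NC.joined φ ψ) u₃ - P1NC.comb φ u₄)) ≤
              C * h ^ 2 * P1NC.l2Norm ℓ f ∧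
          P1NC.energyNorm ℓ (P1NC.comb (P1NC.joined φ ψ) u₃ - P1NC.comb φ u₄) ≤
              C * h * P1NC.l2Norm ℓ f := by
  refine ⟨1, one_pos, ?_⟩
  intro ℓ hℓ N _ hN h hh f hf2 h0 Bf hB Af hA φ ψ φf ψf
  have : IsFiniteMeasure (volume.restrict (P1NC.Omega ℓ)) :=
    ⟨by simpa using (P1NC.integrableOn_const_one (ℓ := ℓ)).2.lt_top⟩
  have hf : IntegrableOn f (P1NC.Omega ℓ) := hf2.integrable one_le_two
  have hex1 := P1NC.exists_isAdmissibleLast hℓ hN hB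
  refine ⟨hex1, fun last hlast => P1NC.existsUnique_solves1 hℓ hN f hB hA hlast, ?_,
    P1NC.exists_solves23 hℓ hN hf h0, fun u₀ _ => P1NC.existsUnique_krylov_solution
      (P1NC.stiffness_isSymm _) (P1NC.exists_node_solution hℓ hN hf h0) u₀, ?_⟩
  -- The second option inherits unique solvability from the first, for any admissible last element.
  · obtain ⟨last, hlast⟩ := hex1
    exact (existsUnique_congr (P1NC.solves1_iff_solves23 hℓ hf h0 hlast ψf)).1
      (P1NC.existsUnique_solves1 hℓ hN f hB hA hlast)
  intro last hlast u₁ hu₁ u₂ hu₂ u₃ hu₃ u₀ hu₀ u₄ hu₄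
  have h12 : u₁ = u₂ := (P1NC.existsUnique_solves1 hℓ hN f hB hA hlast).unique hu₁
    ((P1NC.solves1_iff_solves23 hℓ hf h0 hlast ψf u₂).2 hu₂)
  obtain ⟨⟨hn2, hs2⟩, ha2⟩ := P1NC.solves23_iff.1 hu₂
  obtain ⟨⟨hn3, hs3⟩, ha3⟩ := P1NC.solves23_iff.1 hu₃
  have hg2 := P1NC.isGalerkin_comb hℓ hf hn2
  have hg3 := P1NC.isGalerkin_comb hℓ hf hn3
  have hg4 := P1NC.isGalerkin_comb hℓ hf hu₄.1
  have hga2 := P1NC.isGalerkin_comb hℓ hf ha2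
  have hga3 := P1NC.isGalerkin_comb hℓ hf ha3
  rw [P1NC.span_nodeBasis hℓ hN hB] at hg2
  rw [P1NC.span_altSelection hA] at hga2
  have hc3 : P1NC.cellSum ℓ N (P1NC.comb φ (u₃ ∘ Sum.inl)) = 0 := by
    rw [P1NC.cellSum_comb hN (fun z => z), hs3, mul_zero]
  have hnode23 : P1NC.comb φf (u₂ ∘ Sum.inl) = P1NC.comb φ (u₃ ∘ Sum.inl) := by
    refine hg2.eq_of_cellSum_eq_zero hℓ hN hg3 ?_ hc3
    rw [P1NC.cellSum_comb hN (fun z : Bf => (z : P1NC.Node N)), hs2, mul_zero]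
  have hnode34 : P1NC.comb φ (u₃ ∘ Sum.inl) = P1NC.comb φ u₄ := by
    refine hg3.eq_of_cellSum_eq_zero hℓ hN hg4 hc3 ?_
    rw [P1NC.cellSum_comb hN (fun z => z),
      P1NC.sum_eq_zero_of_solves4 hℓ hN hf h0 hu₀ hu₄, mul_zero]
  have hv3 := P1NC.evalAt_comb_altFun (ℓ := ℓ) (fun a : P1NC.AltIdx N => a) (u₃ ∘ Sum.inr)
  have halt23 : P1NC.comb ψf (u₂ ∘ Sum.inr) = P1NC.comb ψ (u₃ ∘ Sum.inr) := by
    refine sub_eq_zero.1 (P1NC.eq_zero_of_energy_of_center_eq_zero hℓ (fun k => ?_)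
      (hga2.energy_sub_eq_zero hℓ hga3))
    rw [map_sub, hv3,
      P1NC.evalAt_comb_altFun (fun a : Af => (a : P1NC.AltIdx N)), sub_zero]
  -- The node parts cancel; what remains has vanishing barycenter values and is a Galerkin solution
  -- itself.
  have hdiff : P1NC.comb (P1NC.joined φ ψ) u₃ - P1NC.comb φ u₄ =
      P1NC.comb ψ (u₃ ∘ Sum.inr) := by
    rw [P1NC.comb_joined, hnode34, add_sub_cancel_left]
  have hh0 : 0 < h := (P1NC.step_pos hℓ N 0).trans_le (hh 0)
  have hE := P1NC.energy_le_of_center_eq_zero hh0 hℓ hh hf2 hf hv3 (hga3.2 _ hga3.1)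
  have hW := P1NC.integral_sq_le_of_center_eq_zero hℓ hh hv3
  refine ⟨by rw [h12], by rw [P1NC.comb_joined, P1NC.comb_joined, hnode23, halt23], ?_, ?_⟩
  · rw [hdiff, one_mul, P1NC.l2Norm, P1NC.l2Norm]
    refine Real.sqrt_le_iff.2 ⟨by positivity, ?_⟩
    rw [mul_pow, Real.sq_sqrt (integral_nonneg fun _ => sq_nonneg _)]
    calc _ ≤ h ^ 2 * (h ^ 2 * ∫ x in P1NC.Omega ℓ, f x ^ 2) :=
          hW.trans (mul_le_mul_of_nonneg_left hE (sq_nonneg h))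
      _ = _ := by ring
  · rw [hdiff, one_mul, P1NC.energyNorm, P1NC.l2Norm]
    refine Real.sqrt_le_iff.2 ⟨by positivity, ?_⟩
    rw [mul_pow, Real.sq_sqrt (integral_nonneg fun _ => sq_nonneg _)]
    exact hE
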